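/- **Theorem.** A partition of a positive integer $n$ is a weakly decreasing sequence $\lambda=(\lambda_1,\dots,\lambda_m)$ of positive integers with $\lambda_1+\cdots+\lambda_m=n$; put $\lambda_j=0$ for $j>m$. For partitions $\lambda,\mu$ of $n$, say that $\lambda$ dominates $\mu$, written $\lambda\succeq\mu$, if $$\sum_{j=1}^{i}\mu_j\le\sum_{j=1}^{i}\lambda_j\qquad\text{for all } i\ge 1.$$ Let $Q(n)=P(\lambda\succeq\mu)$, where $\lambda$ and $\mu$ are two independent random partitions, each uniformly distributed on the set of all partitions of $n$. Then there is an $N$ such that for all $n\ge N$ $$Q(n)\le\exp\left(-\frac{0.11\,\log n}{\log\log n}\right).$$ -/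

import Mathlib

open scoped BigOperators

namespace RandomPartition

/-- The parts of a partition `lam` of `n` in weakly decreasing order, extended by zeros:
`part lam j` is the `(j + 1)`-st largest part of `lam`, and `0` once the parts are exhausted. -/
def part {n : ℕ} (lam : n.Partition) (j : ℕ) : ℕ :=
  (lam.parts.sort (· ≥ ·)).getD j 0

/-- The dominance order on the partitions of `n`: `DominatedBy lam mu` says that for every `i` the
sum of the `i` largest parts of `lam` is at most the sum of the `i` largest parts of `mu`. -/
def DominatedBy {n : ℕ} (lam mu : n.Partition) : Prop :=
  ∀ i : ℕ, ∑ j ∈ Finset.range i, part lam j ≤ ∑ j ∈ Finset.range i, part mu j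

/-- Every subset of the finite set of partitions of `n` is an event. -/
instance instMeasurableSpacePartition (n : ℕ) : MeasurableSpace n.Partition := ⊤

/-- The uniform distribution on the set of partitions of `n`. -/
noncomputable def uniformPartition (n : ℕ) : MeasureTheory.Measure n.Partition :=
  ProbabilityTheory.uniformOn Set.univ

/-- Macdonald's probability: the probability that `lam` dominates `mu`, where `lam` and `mu` are
independent uniformly random partitions of `n`. -/
noncomputable def macdonaldProb (n : ℕ) : ℝ :=
  ((uniformPartition n).prod (uniformPartition n)).real
    {p : n.Partition × n.Partition | DominatedBy p.2 p.1}

end RandomPartition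

namespace RandomPartition

open Finset

/-! The bound proved is in fact polynomial: the probability is at most a constant times `n ^ (-c)`
for some `c > 0`, which for large `n` is far below the required quantity.

If `lam` dominates `mu`, then for every `t` the sum of the parts truncated at `t` is at most as
large for `lam` as for `mu` (`DominatedBy.capSum_le`). This is tested at the `K` levels `t = 2r`, `r
= 16 ^ (K + k)`, with `K` of order `log n`. At a positive proportion of the levels the discrepancy
of the two truncated sums should have a chance bounded below of being positive, with enough
independence between levels to give a bound exponential in `K`.

The independence is produced by hand. At scale `r`, take quadruples `x, x + r, x + 2r, x + 3r` with
`r/2 < x ≤ r`, and exchange `b` copies of the outer sizes for `b` copies of the inner ones. This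
preserves the sum of the parts, changes the truncated sum at level `2r` by `± r b`, and leaves the
other tested levels alone (`slope_scaleSystem`). A parity rule makes each exchange an involution, so
the uniform distribution is invariant. Within an orbit the discrepancy at each level is a `center`
plus a Rademacher sum, and different levels use disjoint sets of signs (`disc_flip_scaleSystem`).
With `r b` of order `√n` and at least `r/4` active quadruples, the fluctuation at level `2r` has
order `√n √r`. A Rademacher sum exceeds `D` standard deviations with probability at least some `δ(D)
> 0` (`card_signs_ge`), so every level whose center is of this order contributes a factor `1 - δ`.

Two exceptional events must have probability exponentially small in `K`: too many small
multiplicities (`exists_card_small_mult_le`), and centers too large at more than half of the levels.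
The second follows from a joint exponential moment of all normalised discrepancies
(`exists_sum_exp_disc_le`), which passes to centers by convexity (`QuadSystem.sum_exp_center_le`).
Both are computed for independent geometric multiplicities. Passing to uniform partitions costs a
power of `n` (`exists_sum_prod_mult_le`), that is `exp (O(K))`, which is affordable because the
thresholds are chosen afterwards. The cost is polynomial by an elementary lower bound for the number
of partitions (`exists_growth_le_numPart`). -/

/-! ### Multiplicities of parts -/

/-- The multiplicity of `s` as a part of `lam`. -/
def mult {n : ℕ} (lam : n.Partition) (s : ℕ) : ℕ := lam.parts.count s

lemma mult_eq_zero {n : ℕ} (lam : n.Partition) {s : ℕ} (hs : s ∉ Icc 1 n) : mult lam s = 0 := by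
  refine Multiset.count_eq_zero_of_notMem fun h => hs ?_
  have h1 := lam.parts_pos h
  have h2 := Multiset.le_sum_of_mem h
  rw [lam.parts_sum] at h2
  exact Finset.mem_Icc.2 ⟨h1, h2⟩

lemma toFinset_parts_subset {n : ℕ} (lam : n.Partition) : lam.parts.toFinset ⊆ Icc 1 n := by
  intro s hs
  by_contra h
  have := mult_eq_zero lam h
  exact (Multiset.count_ne_zero.2 (Multiset.mem_toFinset.1 hs)) this

lemma sum_map_eq {n : ℕ} (lam : n.Partition) (f : ℕ → ℕ) :
    (lam.parts.map f).sum = ∑ s ∈ Icc 1 n, f s * mult lam s := by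
  rw [Finset.sum_multiset_map_count]
  refine (Finset.sum_subset (toFinset_parts_subset lam) ?_).trans ?_
  · intro s _ hs
    rw [Multiset.count_eq_zero_of_notMem (fun h => hs (Multiset.mem_toFinset.2 h)), zero_smul]
  · exact Finset.sum_congr rfl fun s _ => by simp [mult, mul_comm]

lemma sum_mul_mult {n : ℕ} (lam : n.Partition) : ∑ s ∈ Icc 1 n, s * mult lam s = n := by
  rw [← sum_map_eq lam (fun s => s), Multiset.map_id', lam.parts_sum]

lemma mult_le {n : ℕ} (lam : n.Partition) (s : ℕ) : mult lam s ≤ n := by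
  by_cases hs : s ∈ Icc 1 n
  · have h := Finset.single_le_sum (f := fun s => s * mult lam s) (fun _ _ => Nat.zero_le _) hs
    rw [sum_mul_mult] at h
    exact le_trans (Nat.le_mul_of_pos_left _ (Finset.mem_Icc.1 hs).1) h
  · simp [mult_eq_zero lam hs]

lemma mult_injective (n : ℕ) : Function.Injective (mult : n.Partition → ℕ → ℕ) := by
  intro x y h
  exact Nat.Partition.ext (Multiset.ext.2 fun s => congrFun h s)

/-- The partition of `n` with prescribed multiplicities. -/
def ofMult (n : ℕ) (m : ℕ → ℕ) (h : ∑ s ∈ Icc 1 n, s * m s = n) : n.Partition where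
  parts := ∑ s ∈ Icc 1 n, Multiset.replicate (m s) s
  parts_pos := by
    intro i hi
    obtain ⟨s, hs, hi⟩ := Multiset.mem_sum.1 hi
    rw [Multiset.eq_of_mem_replicate hi]
    exact (Finset.mem_Icc.1 hs).1
  parts_sum := by
    rw [Multiset.sum_sum]
    simpa [Multiset.sum_replicate, mul_comm] using h

lemma mult_ofMult {n : ℕ} {m : ℕ → ℕ} (h : ∑ s ∈ Icc 1 n, s * m s = n) {s : ℕ}
    (hs : s ∈ Icc 1 n) : mult (ofMult n m h) s = m s := by
  simp only [mult, ofMult, Multiset.count_sum', Multiset.count_replicate]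
  rw [Finset.sum_eq_single s] <;> simp +contextual
  intro h1
  have := Finset.mem_Icc.1 hs
  omega

/-- The number of partitions of `n`. -/
def numPart (n : ℕ) : ℕ := Fintype.card n.Partition

lemma numPart_pos (n : ℕ) : 0 < numPart n := Fintype.card_pos

lemma numPart_sub_le {n k v : ℕ} (hv : 0 < v) (h : k * v ≤ n) :
    numPart (n - k * v) ≤ #{lam : n.Partition | k ≤ mult lam v} := by
  classical
  let f : (n - k * v).Partition → n.Partition := fun lam =>
    ⟨lam.parts + Multiset.replicate k v, by
      intro i hi
      rcases Multiset.mem_add.1 hi with hi | hi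
      · exact lam.parts_pos hi
      · rw [Multiset.eq_of_mem_replicate hi]; exact hv, by
      rw [Multiset.sum_add, lam.parts_sum, Multiset.sum_replicate, smul_eq_mul]; omega⟩
  rw [numPart, ← Finset.card_univ]
  refine Finset.card_le_card_of_injOn f ?_ ?_
  · intro lam _
    rw [Finset.mem_coe, Finset.mem_filter]
    exact ⟨Finset.mem_univ _, by simp [f, mult]⟩
  · intro x _ y _ hxy
    have := congrArg Nat.Partition.parts hxy
    exact Nat.Partition.ext (add_right_cancel this)

/-- Double counting of the total size of all partitions: a multiplicity is the number of `k ≥ 1` not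
exceeding it, and removing `k` copies of `v` counts the partitions with multiplicity at least `k`.
This is the recursion behind the lower bound for `numPart`. -/
lemma sum_mul_numPart_le (n N : ℕ) :
    ∑ k ∈ Icc 1 N, ∑ v ∈ Icc 1 n, (if k * v ≤ n then v * numPart (n - k * v) else 0)
      ≤ n * numPart n := by
  classical
  have h1 : n * numPart n = ∑ lam : n.Partition, ∑ v ∈ Icc 1 n, v * mult lam v := by
    simp only [sum_mul_mult, Finset.sum_const, Finset.card_univ, numPart, smul_eq_mul, mul_comm]
  have h2 : ∀ (lam : n.Partition) (v : ℕ),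
      ∑ k ∈ Icc 1 N, (if k ≤ mult lam v then v else 0) ≤ v * mult lam v := by
    intro lam v
    rw [← Finset.sum_filter, Finset.sum_const, smul_eq_mul, mul_comm]
    refine Nat.mul_le_mul_left _ ?_
    calc _ ≤ #(Icc 1 (mult lam v)) := Finset.card_le_card (by intro k; simp; omega)
      _ = _ := by simp
  rw [h1, Finset.sum_comm, Finset.sum_comm (s := univ)]
  refine Finset.sum_le_sum fun v hv => ?_
  refine le_trans ?_ (Finset.sum_le_sum fun lam _ => h2 lam v)
  rw [Finset.sum_comm]
  refine Finset.sum_le_sum fun k _ => ?_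
  split_ifs with hk
  · rw [← Finset.sum_filter, Finset.sum_const, smul_eq_mul, mul_comm]
    exact Nat.mul_le_mul_right _ (numPart_sub_le (Finset.mem_Icc.1 hv).1 hk)
  · exact Nat.zero_le _

/-! ### Geometric sums -/

lemma hasSum_geo_shift (j : ℕ) {r : ℝ} (hr0 : 0 ≤ r) (hr : r < 1) :
    HasSum (fun w : ℕ => ((w + j).choose j : ℝ) * r ^ (w + 1)) (r / (1 - r) ^ (j + 1)) := by
  have h := (hasSum_choose_mul_geometric_of_norm_lt_one (𝕜 := ℝ) j
    (r := r) (by rwa [Real.norm_eq_abs, abs_of_nonneg hr0])).mul_left r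
  rw [mul_one_div] at h
  refine h.congr_fun ?_
  intro w
  ring

lemma tsum_pow_mul_le (j : ℕ) {r : ℝ} (hr0 : 0 ≤ r) (hr : r < 1) :
    ∑' v : ℕ, (v : ℝ) ^ (j + 1) * r ^ v ≤ (j + 1).factorial * (r / (1 - r) ^ (j + 2)) := by
  have hs := summable_pow_mul_geometric_of_norm_lt_one (R := ℝ) (j + 1)
    (r := r) (by rwa [Real.norm_eq_abs, abs_of_nonneg hr0])
  rw [hs.tsum_eq_zero_add]
  have h := (hasSum_geo_shift (j + 1) hr0 hr).mul_left ((j + 1).factorial : ℝ)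
  simp only [Nat.cast_zero, ne_eq, Nat.add_eq_zero_iff, one_ne_zero, and_false, not_false_eq_true,
    zero_pow, pow_zero, mul_one, zero_add]
  rw [← h.tsum_eq]
  refine Summable.tsum_le_tsum (fun w => ?_) ((summable_nat_add_iff 1).2 hs) h.summable
  rw [← mul_assoc]
  refine mul_le_mul_of_nonneg_right ?_ (pow_nonneg hr0 _)
  have h1 := Nat.pow_succ_le_ascFactorial (w + 1) (j + 1)
  rw [Nat.ascFactorial_eq_factorial_mul_choose] at h1
  exact_mod_cast h1

lemma le_tsum_sq_mul {r : ℝ} (hr0 : 0 ≤ r) (hr : r < 1) :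
    r / (1 - r) ^ 3 ≤ ∑' v : ℕ, (v : ℝ) ^ 2 * r ^ v := by
  have hs := summable_pow_mul_geometric_of_norm_lt_one (R := ℝ) 2
    (r := r) (by rwa [Real.norm_eq_abs, abs_of_nonneg hr0])
  rw [hs.tsum_eq_zero_add]
  have h := hasSum_geo_shift 2 hr0 hr
  simp only [Nat.cast_zero, ne_eq, OfNat.ofNat_ne_zero, not_false_eq_true,
    zero_pow, pow_zero, mul_one, zero_add]
  rw [← h.tsum_eq]
  refine Summable.tsum_le_tsum (fun w => ?_) h.summable ((summable_nat_add_iff 1).2 hs)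
  refine mul_le_mul_of_nonneg_right ?_ (pow_nonneg hr0 _)
  have h1 : (w + 2).choose 2 ≤ (w + 1) ^ 2 := by
    rw [Nat.choose_two_right]
    refine Nat.div_le_of_le_mul ?_
    simp only [show w + 2 - 1 = w + 1 by omega]
    nlinarith
  exact_mod_cast h1

/-- Combine `x / (1 + x) ≤ 1 - exp (-x)` with `1 + x ≤ m * exp (x / m)` for `m = j + 1`. The
constant is crude but explicit. -/
lemma exp_neg_div_le {x : ℝ} (hx : 0 < x) (j : ℕ) :
    Real.exp (-x) / (1 - Real.exp (-x)) ^ (j + 1) ≤ (j + 1 : ℕ) ^ (j + 1) / x ^ (j + 1) := by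
  have h1 : Real.exp (-x) < 1 := by rw [← Real.exp_zero]; exact Real.exp_lt_exp.2 (by linarith)
  have h2 : 0 < 1 - Real.exp (-x) := by linarith
  have h3 : x / (1 + x) ≤ 1 - Real.exp (-x) := by
    have : Real.exp (-x) ≤ 1 / (1 + x) := by
      rw [Real.exp_neg, inv_eq_one_div]
      exact one_div_le_one_div_of_le (by linarith) (by linarith [Real.add_one_le_exp x])
    have e : x / (1 + x) = 1 - 1 / (1 + x) := by field_simp; ring
    linarith
  have h4 : (1 + x) ^ (j + 1) ≤ (j + 1 : ℕ) ^ (j + 1) * Real.exp x := by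
    have h5 : 1 + x ≤ (j + 1 : ℕ) * Real.exp (x / (j + 1 : ℕ)) := by
      have := Real.add_one_le_exp (x / (j + 1 : ℕ))
      have hj : (1 : ℝ) ≤ (j + 1 : ℕ) := by exact_mod_cast Nat.succ_le_succ (Nat.zero_le j)
      calc 1 + x ≤ (j + 1 : ℕ) * (x / (j + 1 : ℕ) + 1) := by field_simp; linarith
        _ ≤ _ := by gcongr
    calc (1 + x) ^ (j + 1) ≤ ((j + 1 : ℕ) * Real.exp (x / (j + 1 : ℕ))) ^ (j + 1) := by gcongr
      _ = _ := by
        rw [mul_pow, ← Real.exp_nat_mul]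
        congr 2
        field_simp
  rw [div_le_div_iff₀ (by positivity) (by positivity)]
  have h6 : x ^ (j + 1) ≤ (1 + x) ^ (j + 1) * (1 - Real.exp (-x)) ^ (j + 1) := by
    rw [← mul_pow]
    have : x ≤ (1 + x) * (1 - Real.exp (-x)) := by
      rw [div_le_iff₀ (by linarith)] at h3; linarith
    gcongr
  calc Real.exp (-x) * x ^ (j + 1)
      ≤ Real.exp (-x) * (((j + 1 : ℕ) ^ (j + 1) * Real.exp x) * (1 - Real.exp (-x)) ^ (j + 1)) := by
        gcongr
        exact h6.trans (by gcongr)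
    _ = _ := by
        have : Real.exp (-x) * Real.exp x = 1 := by rw [← Real.exp_add]; simp
        linear_combination ((j + 1 : ℕ) : ℝ) ^ (j + 1) * (1 - Real.exp (-x)) ^ (j + 1) * this

lemma one_sub_exp_sq (x : ℝ) :
    (1 - Real.exp (-x)) ^ 2 = Real.exp (-x) * (2 * (Real.cosh x - 1)) := by
  rw [Real.cosh_eq]
  have : Real.exp (-x) * Real.exp x = 1 := by rw [← Real.exp_add]; simp
  linear_combination -this

lemma sq_le_two_mul_cosh (x : ℝ) : x ^ 2 ≤ 2 * (Real.cosh x - 1) := by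
  have h1 := Real.cosh_two_mul (|x| / 2)
  have h2 := Real.self_le_sinh_iff.2 (show 0 ≤ |x| / 2 by positivity)
  have h3 := Real.cosh_sq (|x| / 2)
  rw [show 2 * (|x| / 2) = |x| by ring, Real.cosh_abs] at h1
  have h4 : |x| ^ 2 = x ^ 2 := sq_abs x
  nlinarith [mul_self_le_mul_self (show 0 ≤ |x| / 2 by positivity) h2]

/-- The right side equals `1 / (2 (cosh x - 1))`, and `cosh x ≤ exp (x² / 2)` bounds it below. The
expansion at zero is `1/x² - 1/12 + ⋯`; the weaker `1/2` suffices. -/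
lemma le_exp_neg_div_sq {x : ℝ} (hx : 0 < x) :
    1 / x ^ 2 - 1 / 2 ≤ Real.exp (-x) / (1 - Real.exp (-x)) ^ 2 := by
  have h0 : 0 < 2 * (Real.cosh x - 1) := lt_of_lt_of_le (by positivity) (sq_le_two_mul_cosh x)
  rw [one_sub_exp_sq, ← div_div, div_self (Real.exp_pos _).ne']
  rw [le_div_iff₀ h0]
  by_cases h : x ^ 2 / 2 < 1
  · have h1 := Real.cosh_le_exp_half_sq x
    have h2 : Real.exp (x ^ 2 / 2) * (1 - x ^ 2 / 2) ≤ 1 := by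
      have := Real.one_sub_le_exp_neg (x ^ 2 / 2)
      calc _ ≤ Real.exp (x ^ 2 / 2) * Real.exp (-(x ^ 2 / 2)) := by gcongr
        _ = 1 := by rw [← Real.exp_add]; simp
    have h3 : Real.cosh x * (1 - x ^ 2 / 2) ≤ 1 :=
      le_trans (mul_le_mul_of_nonneg_right h1 (by linarith)) h2
    have : (1 / x ^ 2 - 1 / 2) = (1 - x ^ 2 / 2) / x ^ 2 := by field_simp
    rw [this, div_mul_eq_mul_div, div_le_one (by positivity)]
    nlinarith
  · have : 1 / x ^ 2 - 1 / 2 ≤ 0 := by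
      rw [sub_nonpos]
      exact one_div_le_one_div_of_le (by norm_num) (by linarith)
    nlinarith

/-! ### A lower bound for the number of partitions -/

lemma sum_inv_sq_le (N : ℕ) : ∑ k ∈ Icc 1 N, 1 / (k : ℝ) ^ 2 ≤ Real.pi ^ 2 / 6 :=
  sum_le_hasSum _ (fun _ _ => by positivity) hasSum_zeta_two

lemma le_sum_inv_sq {N : ℕ} (hN : N ≠ 0) :
    Real.pi ^ 2 / 6 - 1 / N ≤ ∑ k ∈ Icc 1 N, 1 / (k : ℝ) ^ 2 := by
  rw [sub_le_iff_le_add]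
  refine le_of_tendsto' hasSum_zeta_two.tendsto_sum_nat fun M => ?_
  have h1 : range M ⊆ insert 0 (Icc 1 N ∪ Ioc N (max N M)) := by
    intro x; simp; omega
  refine (Finset.sum_le_sum_of_subset_of_nonneg h1 fun _ _ _ => by positivity).trans ?_
  rw [Finset.sum_insert (by simp), Finset.sum_union]
  · have := sum_Ioc_inv_sq_le_sub (α := ℝ) hN (le_max_left N M)
    have h2 : (0 : ℝ) ≤ ((max N M : ℕ) : ℝ)⁻¹ := by positivity
    simp only [one_div] at *
    simp only [Nat.cast_zero, ne_eq, OfNat.ofNat_ne_zero, not_false_eq_true, zero_pow, inv_zero]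
    linarith
  · rw [Finset.disjoint_left]
    intro x; simp; omega

lemma le_inner_sum {u C : ℝ} {n k : ℕ} (hu : 0 < u) (hn : 0 < n) (hun : 1 ≤ u * n) (hC : 0 ≤ C)
    (hk : 0 < k) :
    1 / (u * k) ^ 2 - 1 / 2
        + C * k / (n + 1) * (Real.exp (-(u * k)) / (1 - Real.exp (-(u * k))) ^ 3)
        - 1536 / (n * u ^ 3) * (1 / (k : ℝ) ^ 2) - 75000 * C / (n ^ 2 * u ^ 4) * (1 / (k : ℝ) ^ 2)
      ≤ ∑ v ∈ Icc 1 n, if k * v ≤ n then (v : ℝ) * (Real.exp (-(u * (k * v : ℕ))) *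
          (1 + C * (k * v : ℕ) / (n + 1) - u * (k * v : ℕ) ^ 2 / n
            - u * C * (k * v : ℕ) ^ 3 / n ^ 2)) else 0 := by
  have hk' : (0 : ℝ) < k := by exact_mod_cast hk
  have hn' : (0 : ℝ) < n := by exact_mod_cast hn
  have hx : 0 < u * k := by positivity
  set r := Real.exp (-(u * k)) with hr
  have hr0 : 0 ≤ r := (Real.exp_pos _).le
  have hr1 : r < 1 := by rw [← Real.exp_zero]; exact Real.exp_lt_exp.2 (by linarith)
  have hs : ∀ j, Summable fun v : ℕ => (v : ℝ) ^ j * r ^ v := fun j =>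
    summable_pow_mul_geometric_of_norm_lt_one (R := ℝ) j
      (by rwa [Real.norm_eq_abs, abs_of_nonneg hr0])
  set F : ℕ → ℝ := fun v => (v : ℝ) * (Real.exp (-(u * (k * v : ℕ))) *
          (1 + C * (k * v : ℕ) / (n + 1) - u * (k * v : ℕ) ^ 2 / n
            - u * C * (k * v : ℕ) ^ 3 / n ^ 2)) with hF
  have hFeq : ∀ v, F v = (v : ℝ) ^ 1 * r ^ v + C * k / (n + 1) * ((v : ℝ) ^ 2 * r ^ v)
      - u * k ^ 2 / n * ((v : ℝ) ^ 3 * r ^ v) - u * C * k ^ 3 / n ^ 2 * ((v : ℝ) ^ 4 * r ^ v) := by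
    intro v
    have : Real.exp (-(u * (k * v : ℕ))) = r ^ v := by
      rw [hr, ← Real.exp_nat_mul]; push_cast; ring_nf
    simp only [hF, this]
    push_cast
    ring
  have hsum : HasSum F (∑' v : ℕ, (v : ℝ) ^ 1 * r ^ v
      + C * k / (n + 1) * (∑' v : ℕ, (v : ℝ) ^ 2 * r ^ v)
      - u * k ^ 2 / n * (∑' v : ℕ, (v : ℝ) ^ 3 * r ^ v)
      - u * C * k ^ 3 / n ^ 2 * (∑' v : ℕ, (v : ℝ) ^ 4 * r ^ v)) := by
    rw [show F = _ from funext hFeq]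
    exact ((((hs 1).hasSum).add ((hs 2).hasSum.mul_left _)).sub ((hs 3).hasSum.mul_left _)).sub
      ((hs 4).hasSum.mul_left _)
  -- For `k v > n` the quadratic and cubic losses outweigh the positive terms, so completing the
  -- finite sum to a full series only lowers it.
  have hneg : ∀ v ∉ (Icc 1 n).filter (fun v => k * v ≤ n), 0 ≤ -F v := by
    intro v hv
    rcases Nat.eq_zero_or_pos v with rfl | hv0
    · simp [hF]
    have hkv : n < k * v := by
      by_contra hcon
      push Not at hcon
      refine hv (Finset.mem_filter.2 ⟨Finset.mem_Icc.2 ⟨hv0, ?_⟩, hcon⟩)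
      exact le_trans (Nat.le_mul_of_pos_left _ hk) hcon
    have hkv' : (n : ℝ) ≤ ((k * v : ℕ) : ℝ) := by exact_mod_cast hkv.le
    simp only [hF]
    set x : ℝ := ((k * v : ℕ) : ℝ)
    have hx0 : 0 < x := lt_of_lt_of_le hn' hkv'
    have h1 : 1 ≤ u * x ^ 2 / n := by
      rw [le_div_iff₀ hn', one_mul]
      calc (n : ℝ) ≤ (u * n) * n := by nlinarith
        _ = u * n ^ 2 := by ring
        _ ≤ u * x ^ 2 := by gcongr
    have h2 : C * x / (n + 1) ≤ u * C * x ^ 3 / n ^ 2 := by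
      calc C * x / (n + 1) ≤ C * x / n * 1 := by
            rw [mul_one]
            exact div_le_div_of_nonneg_left (by positivity) hn' (by linarith)
        _ ≤ C * x / n * (u * x ^ 2 / n) := by gcongr
        _ = _ := by field_simp
    have h3 : 0 ≤ (v : ℝ) * Real.exp (-(u * x)) := by positivity
    nlinarith
  have hle := Summable.sum_le_tsum ((Icc 1 n).filter (fun v => k * v ≤ n)) hneg hsum.summable.neg
  rw [tsum_neg, Finset.sum_neg_distrib, neg_le_neg_iff, hsum.tsum_eq, Finset.sum_filter] at hle
  refine le_trans ?_ hle
  have e1 : ∑' v : ℕ, (v : ℝ) ^ 1 * r ^ v = r / (1 - r) ^ 2 := by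
    simp only [pow_one]
    exact tsum_coe_mul_geometric_of_norm_lt_one (by rwa [Real.norm_eq_abs, abs_of_nonneg hr0])
  have e2 := le_tsum_sq_mul hr0 hr1
  -- The constants in the statement are `1536 = 3! * 4 ^ 4` and `75000 = 4! * 5 ^ 5`.
  have e3 := (tsum_pow_mul_le 2 hr0 hr1).trans
    (mul_le_mul_of_nonneg_left (exp_neg_div_le hx 3) (by positivity))
  have e4 := (tsum_pow_mul_le 3 hr0 hr1).trans
    (mul_le_mul_of_nonneg_left (exp_neg_div_le hx 4) (by positivity))
  have e0 := le_exp_neg_div_sq hx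
  norm_num [Nat.factorial] at e3 e4
  rw [e1]
  have f2 : C * k / (n + 1) * (r / (1 - r) ^ 3)
      ≤ C * k / (n + 1) * ∑' v : ℕ, (v : ℝ) ^ 2 * r ^ v := by gcongr
  have f3 : u * k ^ 2 / n * ∑' v : ℕ, (v : ℝ) ^ 3 * r ^ v
      ≤ 1536 / (n * u ^ 3) * (1 / (k : ℝ) ^ 2) := by
    refine (mul_le_mul_of_nonneg_left e3 (by positivity)).trans (le_of_eq ?_)
    field_simp
    norm_num
  have f4 : u * C * k ^ 3 / n ^ 2 * ∑' v : ℕ, (v : ℝ) ^ 4 * r ^ v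
      ≤ 75000 * C / (n ^ 2 * u ^ 4) * (1 / (k : ℝ) ^ 2) := by
    refine (mul_le_mul_of_nonneg_left e4 (by positivity)).trans (le_of_eq ?_)
    field_simp
    ring
  linarith

/-- The Boltzmann parameter of partitions of `n`. -/
noncomputable def rate (n : ℕ) : ℝ := Real.pi / √(6 * n)

lemma rate_pos {n : ℕ} (hn : 0 < n) : 0 < rate n := by
  have : (0 : ℝ) < n := by exact_mod_cast hn
  unfold rate; positivity

lemma rate_sq_mul {n : ℕ} (hn : 0 < n) : rate n ^ 2 * n = Real.pi ^ 2 / 6 := by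
  have : (0 : ℝ) < n := by exact_mod_cast hn
  rw [rate, div_pow, Real.sq_sqrt (by positivity)]
  field_simp

/-- With `u = rate n`, the main term `∑ 1/(u k)²` is `n` up to `2/u`, because `u² n = ζ(2)`. The
value 8000 makes the gain from the polynomial factor, already `2000/u` at `k = 1`, exceed the losses
`2/u`, `1/(2u)` and `1536/u`. The remaining loss `75000 * 8000` is absorbed since `1/u ≥ 10 ^ 7`. -/
lemma le_outer_sum {n : ℕ} (hn : 0 < n) (hu : rate n ≤ 1 / 10 ^ 7) :
    (n : ℝ) ≤ ∑ k ∈ Icc 1 ⌊1 / rate n⌋₊, ∑ v ∈ Icc 1 n, if k * v ≤ n then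
      (v : ℝ) * (Real.exp (-(rate n * (k * v : ℕ))) *
          (1 + 8000 * (k * v : ℕ) / (n + 1) - rate n * (k * v : ℕ) ^ 2 / n
            - rate n * 8000 * (k * v : ℕ) ^ 3 / n ^ 2)) else 0 := by
  have hn' : (1 : ℝ) ≤ n := by exact_mod_cast hn
  have hu0 := rate_pos hn
  have hZ := rate_sq_mul hn
  set u := rate n
  set N := ⌊1 / u⌋₊
  have hpi1 := Real.pi_gt_three
  have hpi2 := Real.pi_lt_d2
  have hZ1 : 1 ≤ Real.pi ^ 2 / 6 := by nlinarith
  have hZ2 : Real.pi ^ 2 / 6 ≤ 1.7 := by nlinarith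
  have hun : 1 ≤ u * n := by nlinarith
  have hinv : 10 ^ 7 ≤ 1 / u := by
    rw [le_div_iff₀ hu0]; linarith
  have hNle : (N : ℝ) ≤ 1 / u := Nat.floor_le (by positivity)
  have hNge : 1 / u - 1 < N := Nat.sub_one_lt_floor _
  have hN0 : (0 : ℝ) < N := by linarith
  have hN1 : 1 ≤ N := by exact_mod_cast hN0
  have key := Finset.sum_le_sum fun k (hk : k ∈ Icc 1 N) =>
    le_inner_sum hu0 hn hun (show (0 : ℝ) ≤ 8000 by norm_num) (Finset.mem_Icc.1 hk).1
  refine le_trans ?_ key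
  have hlow := le_sum_inv_sq (N := N) (by omega)
  have hup := sum_inv_sq_le N
  rw [Finset.sum_sub_distrib, Finset.sum_sub_distrib, Finset.sum_add_distrib,
    Finset.sum_sub_distrib, ← Finset.mul_sum, ← Finset.mul_sum, Finset.sum_const]
  simp only [Nat.card_Icc, Nat.add_sub_cancel, nsmul_eq_mul]
  set Q := ∑ k ∈ Icc 1 N, 1 / (k : ℝ) ^ 2
  have g1 : (n : ℝ) - 2 / u ≤ ∑ k ∈ Icc 1 N, 1 / (u * k) ^ 2 := by
    have : ∑ k ∈ Icc 1 N, 1 / (u * k) ^ 2 = 1 / u ^ 2 * Q := by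
      rw [Finset.mul_sum]
      exact Finset.sum_congr rfl fun k _ => by rw [mul_pow]; field_simp
    rw [this]
    have h1 : 1 / (N : ℝ) ≤ 2 * u := by
      rw [div_le_iff₀ hN0]
      have : u * (1 / u) = 1 := by field_simp
      nlinarith
    calc (n : ℝ) - 2 / u = 1 / u ^ 2 * (u ^ 2 * n - 2 * u) := by field_simp
      _ ≤ 1 / u ^ 2 * Q := by
        gcongr; linarith
  have g2 : 2000 / u ≤ ∑ k ∈ Icc 1 N, 8000 * (k : ℝ) / (n + 1)
      * (Real.exp (-(u * k)) / (1 - Real.exp (-(u * k))) ^ 3) := by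
    have hterm : ∀ k ∈ Icc 1 N, 0 ≤ 8000 * (k : ℝ) / (n + 1)
      * (Real.exp (-(u * k)) / (1 - Real.exp (-(u * k))) ^ 3) := by
      intro k _
      have : Real.exp (-(u * k)) ≤ 1 := by
        rw [← Real.exp_zero]; exact Real.exp_le_exp.2 (by simp; positivity)
      have : 0 ≤ 1 - Real.exp (-(u * k)) := by linarith
      positivity
    refine le_trans ?_ (Finset.single_le_sum hterm (Finset.mem_Icc.2 ⟨le_refl 1, hN1⟩))
    simp only [Nat.cast_one, mul_one]
    have he := Real.one_sub_le_exp_neg u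
    have he2 : Real.exp (-u) < 1 := by rw [← Real.exp_zero]; exact Real.exp_lt_exp.2 (by linarith)
    have he3 : 0 < 1 - Real.exp (-u) := by linarith
    have h3 : (1 / 2) / u ^ 3 ≤ Real.exp (-u) / (1 - Real.exp (-u)) ^ 3 := by
      gcongr <;> linarith
    have h4 : (n : ℝ) + 1 ≤ 2 / u ^ 2 := by
      rw [le_div_iff₀ (by positivity)]; nlinarith
    calc 2000 / u = 8000 / (2 / u ^ 2) * ((1 / 2) / u ^ 3) := by field_simp; norm_num
      _ ≤ _ := by gcongr
  have g3 : 1536 / (n * u ^ 3) * Q ≤ 1536 / u := by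
    calc 1536 / (n * u ^ 3) * Q ≤ 1536 / (n * u ^ 3) * (u ^ 2 * n) := by
          rw [hZ]; gcongr
      _ = 1536 / u := by field_simp
  have g4 : 75000 * 8000 / (n ^ 2 * u ^ 4) * Q ≤ 75000 * 8000 := by
    calc 75000 * 8000 / (n ^ 2 * u ^ 4) * Q ≤ 75000 * 8000 / (n ^ 2 * u ^ 4) * (u ^ 2 * n) := by
          rw [hZ]; gcongr
      _ = 75000 * 8000 / (u ^ 2 * n) := by field_simp
      _ ≤ 75000 * 8000 := div_le_self (by norm_num) (by linarith)
  have d1 : 2 / u = 2 * (1 / u) := by ring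
  have d2 : 2000 / u = 2000 * (1 / u) := by ring
  have d3 : 1536 / u = 1536 * (1 / u) := by ring
  rw [d1] at g1; rw [d2] at g2; rw [d3] at g3
  linarith

lemma sqrt_mul_le_sqrt_sub {n x : ℝ} (hn : 0 < n) (hx0 : 0 ≤ x) (hx : x ≤ n) :
    √n * (1 - x / n / 2 - (x / n) ^ 2 / 2) ≤ √(n - x) := by
  apply Real.le_sqrt_of_sq_le
  have hy0 : 0 ≤ x / n := by positivity
  have hy1 : x / n ≤ 1 := (div_le_one hn).2 hx
  have hx' : x = n * (x / n) := by field_simp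
  set y := x / n
  rw [mul_pow, Real.sq_sqrt hn.le, hx']
  have : (1 - y / 2 - y ^ 2 / 2) ^ 2 ≤ 1 - y := by
    have e : (1 - y / 2 - y ^ 2 / 2) ^ 2 = (1 - y) * ((1 - y) * (1 + y / 2) ^ 2) := by ring
    have : (1 - y) * (1 + y / 2) ^ 2 ≤ 1 := by nlinarith [mul_nonneg hy0 hy0, pow_nonneg hy0 3]
    rw [e]
    exact mul_le_of_le_one_right (by linarith) this
  nlinarith

lemma rate_eq (n : ℕ) : rate n = Real.pi / √6 / √n := by
  rw [rate, Real.sqrt_mul (by norm_num), div_div]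

lemma rate_mul {n : ℕ} : rate n * n = Real.pi / √6 * √n := by
  rcases Nat.eq_zero_or_pos n with rfl | hn
  · simp
  have : (0 : ℝ) < n := by exact_mod_cast hn
  rw [rate_eq, div_mul_eq_mul_div, div_eq_iff (by positivity), mul_assoc,
    Real.mul_self_sqrt this.le]

/-- The growth comparison function for the number of partitions. -/
noncomputable def growth (C n : ℕ) : ℝ :=
  Real.exp (2 * (Real.pi / √6) * √n) / ((n : ℝ) + 1) ^ C

/-- Expanding `√(n - x)` to second order costs `exp (-(u x) - u x² / n)`, while Bernoulli's
inequality gains `1 + C x / (n + 1)` from the denominator. The cubic term bounds the product of the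
two corrections. -/
lemma growth_mul_le {C n x : ℕ} (hn : 0 < n) (hx : x ≤ n) :
    growth C n * (Real.exp (-(rate n * x)) * (1 + C * x / (n + 1) - rate n * x ^ 2 / n
      - rate n * C * x ^ 3 / n ^ 2)) ≤ growth C (n - x) := by
  have hn' : (0 : ℝ) < n := by exact_mod_cast hn
  have hx' : (x : ℝ) ≤ n := by exact_mod_cast hx
  have hu := rate_pos hn
  have hx0 : (0 : ℝ) ≤ x := Nat.cast_nonneg x
  set E := Real.exp (2 * (Real.pi / √6) * √n) with hE
  set y : ℝ := rate n * x ^ 2 / n with hy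
  have hy0 : 0 ≤ y := by positivity
  have h1 : E * Real.exp (-(rate n * x)) * Real.exp (-y)
      ≤ Real.exp (2 * (Real.pi / √6) * √((n - x : ℕ) : ℝ)) := by
    rw [hE, ← Real.exp_add, ← Real.exp_add, Nat.cast_sub hx]
    apply Real.exp_le_exp.2
    have h := mul_le_mul_of_nonneg_left (sqrt_mul_le_sqrt_sub hn' hx0 hx')
      (show 0 ≤ 2 * (Real.pi / √6) by positivity)
    refine le_trans (le_of_eq ?_) h
    have e : Real.pi / √6 * √n = rate n * n := rate_mul.symm
    rw [hy]
    calc _ = 2 * (Real.pi / √6 * √n) - rate n * x - rate n * x ^ 2 / n := by ring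
      _ = 2 * (Real.pi / √6 * √n) * (1 - x / n / 2 - (x / n) ^ 2 / 2) := by
        rw [e]; field_simp
      _ = _ := by ring
  have h2 : (1 + C * (x : ℝ) / (n + 1)) / ((n : ℝ) + 1) ^ C
      ≤ 1 / (((n - x : ℕ) : ℝ) + 1) ^ C := by
    have hd : (0 : ℝ) < n - x + 1 := by linarith
    rw [Nat.cast_sub hx, div_le_div_iff₀ (by positivity) (by positivity), one_mul]
    have hb := one_add_mul_le_pow (a := (x : ℝ) / (n + 1))
      (le_trans (by norm_num) (show (0 : ℝ) ≤ x / (n + 1) by positivity)) C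
    calc (1 + C * (x : ℝ) / (n + 1)) * ((n : ℝ) - x + 1) ^ C
        ≤ (1 + (x : ℝ) / (n + 1)) ^ C * ((n : ℝ) - x + 1) ^ C := by
          refine mul_le_mul_of_nonneg_right ?_ (by positivity)
          refine le_trans (le_of_eq ?_) hb
          ring
      _ = ((1 + (x : ℝ) / (n + 1)) * ((n : ℝ) - x + 1)) ^ C := (mul_pow _ _ _).symm
      _ ≤ ((n : ℝ) + 1) ^ C := by
          refine pow_le_pow_left₀ (by positivity) ?_ _
          have : (1 + (x : ℝ) / (n + 1)) * ((n : ℝ) - x + 1) = n + 1 - x * x / (n + 1) := by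
            field_simp; ring
          rw [this]
          have : 0 ≤ (x : ℝ) * x / (n + 1) := by positivity
          linarith
  have h3 : 1 + C * (x : ℝ) / (n + 1) - y - rate n * C * x ^ 3 / n ^ 2
      ≤ Real.exp (-y) * (1 + C * (x : ℝ) / (n + 1)) := by
    have hb : 0 ≤ C * (x : ℝ) / (n + 1) := by positivity
    refine le_trans ?_ (mul_le_mul_of_nonneg_right (Real.one_sub_le_exp_neg y) (by positivity))
    have : y * (C * (x : ℝ) / (n + 1)) ≤ rate n * C * x ^ 3 / n ^ 2 := by
      rw [hy]
      calc rate n * x ^ 2 / n * (C * (x : ℝ) / (n + 1))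
          ≤ rate n * x ^ 2 / n * (C * (x : ℝ) / n) := by gcongr; linarith
        _ = _ := by field_simp
    nlinarith
  calc _ ≤ growth C n * (Real.exp (-(rate n * x)) *
        (Real.exp (-y) * (1 + C * (x : ℝ) / (n + 1)))) := by
        have : 0 ≤ growth C n := by unfold growth; positivity
        gcongr
    _ = (E * Real.exp (-(rate n * x)) * Real.exp (-y)) *
        ((1 + C * (x : ℝ) / (n + 1)) / ((n : ℝ) + 1) ^ C) := by
        rw [growth, ← hE]; ring
    _ ≤ Real.exp (2 * (Real.pi / √6) * √((n - x : ℕ) : ℝ)) *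
        (1 / (((n - x : ℕ) : ℝ) + 1) ^ C) := by gcongr
    _ = _ := by rw [growth]; ring

lemma rate_le {n : ℕ} (hn : 10 ^ 15 ≤ n) : rate n ≤ 1 / 10 ^ 7 := by
  have hn' : (10 : ℝ) ^ 15 ≤ n := by exact_mod_cast hn
  have h1 : (4 * 10 ^ 7 : ℝ) ≤ √(6 * n) := by
    apply Real.le_sqrt_of_sq_le; linarith
  rw [rate, div_le_div_iff₀ (by positivity) (by positivity)]
  linarith [Real.pi_le_four]

/-- Strong induction on the recursion `sum_mul_numPart_le`: by `growth_mul_le` and `le_outer_sum`,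
`growth C` satisfies the reverse inequality for large `n`. The constant `c` is small enough that the
claim is trivial below the threshold. -/
theorem exists_growth_le_numPart : ∃ C : ℕ, ∃ c : ℝ, 0 < c ∧ ∀ n, c * growth C n ≤ numPart n := by
  obtain ⟨C, hC⟩ : ∃ C : ℕ, (C : ℝ) = 8000 := ⟨8000, by norm_num⟩
  obtain ⟨n₀, hn₀0, hn₀⟩ : ∃ n₀ : ℕ, 0 < n₀ ∧ ∀ n, n₀ ≤ n → rate n ≤ 1 / 10 ^ 7 :=
    ⟨10 ^ 15, by norm_num, fun n hn => rate_le hn⟩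
  refine ⟨C, Real.exp (-(2 * (Real.pi / √6) * √(n₀ : ℝ))), Real.exp_pos _, ?_⟩
  set c := Real.exp (-(2 * (Real.pi / √6) * √(n₀ : ℝ))) with hc
  intro n
  induction n using Nat.strong_induction_on with
  | _ n ih =>
    rcases le_or_gt n₀ n with hn | hn
    · have hn0 : 0 < n := lt_of_lt_of_le hn₀0 hn
      have hn' : (0 : ℝ) < n := by exact_mod_cast hn0
      have hg : 0 ≤ growth C n := by unfold growth; positivity
      have h1 := le_outer_sum hn0 (hn₀ n hn)
      rw [← hC] at h1
      have h2 : ((∑ k ∈ Icc 1 ⌊1 / rate n⌋₊, ∑ v ∈ Icc 1 n,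
          (if k * v ≤ n then v * numPart (n - k * v) else 0) : ℕ) : ℝ) ≤ ((n * numPart n : ℕ) : ℝ) :=
        Nat.cast_le.2 (sum_mul_numPart_le n _)
      push_cast at h2
      refine le_of_mul_le_mul_left ?_ hn'
      refine le_trans ?_ h2
      calc (n : ℝ) * (c * growth C n) = (c * growth C n) * n := by ring
        _ ≤ _ := mul_le_mul_of_nonneg_left h1 (by positivity)
        _ ≤ _ := by
          rw [Finset.mul_sum]
          refine Finset.sum_le_sum fun k hk => ?_
          rw [Finset.mul_sum]
          refine Finset.sum_le_sum fun v hv => ?_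
          have hpos : 0 < k * v := Nat.mul_pos (Finset.mem_Icc.1 hk).1 (Finset.mem_Icc.1 hv).1
          split_ifs with hkv
          · have h3 := growth_mul_le (C := C) hn0 hkv
            have h4 := ih (n - k * v) (by omega)
            have h5 := (mul_le_mul_of_nonneg_left h3 (show 0 ≤ c from (Real.exp_pos _).le)).trans h4
            refine le_trans (le_of_eq ?_) (mul_le_mul_of_nonneg_left h5 (Nat.cast_nonneg' v))
            ring
          · simp
    · have h1 : (1 : ℝ) ≤ numPart n := by exact_mod_cast numPart_pos n
      refine le_trans ?_ h1
      have h2 : growth C n ≤ Real.exp (2 * (Real.pi / √6) * √(n₀ : ℝ)) := by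
        refine (div_le_self (Real.exp_pos _).le (one_le_pow₀ (by linarith [n.cast_nonneg (α := ℝ)]))).trans ?_
        apply Real.exp_le_exp.2
        gcongr
      calc c * growth C n ≤ c * Real.exp (2 * (Real.pi / √6) * √(n₀ : ℝ)) := by gcongr
        _ = 1 := by rw [hc, ← Real.exp_add]; simp

theorem exists_exp_le_numPart : ∃ C : ℕ, ∃ c : ℝ, 0 < c ∧ ∀ n : ℕ,
    c * Real.exp (2 * (rate n * n)) ≤ ((n : ℝ) + 1) ^ C * numPart n := by
  obtain ⟨C, c, hc, h⟩ := exists_growth_le_numPart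
  refine ⟨C, c, hc, fun n => ?_⟩
  have := h n
  rw [growth, mul_div_assoc', div_le_iff₀ (by positivity)] at this
  rw [rate_mul, ← mul_assoc]
  linarith

/-! ### Comparison with independent geometric multiplicities -/

lemma sum_pow_exp_le {a : ℝ} (ha : 0 < a) (n : ℕ) :
    ∑ s ∈ Icc 1 n, Real.exp (-a) ^ s ≤ 1 / a := by
  have hx0 := Real.exp_pos (-a)
  have hx1 : Real.exp (-a) < 1 := by rw [← Real.exp_zero]; exact Real.exp_lt_exp.2 (by linarith)
  set x := Real.exp (-a) with hx
  have h0 : 0 < 1 - x := by linarith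
  have h1 : (∑ s ∈ Icc 1 n, x ^ s) * (1 - x) ≤ x := by
    have h2 := geom_sum_mul_neg x (n + 1)
    rw [Finset.sum_range_succ'] at h2
    have h3 : ∑ s ∈ Icc 1 n, x ^ s = ∑ s ∈ range n, x ^ (s + 1) := by
      rw [Finset.range_eq_Ico, Finset.sum_Ico_add' (fun s => x ^ s) 0 n 1]
      rfl
    rw [h3]
    have h4 : 0 ≤ x ^ (n + 1) := by positivity
    simp only [pow_zero] at h2
    linarith
  have h5 : x * a ≤ 1 - x := by
    have := Real.add_one_le_exp a
    have h6 : x * Real.exp a = 1 := by rw [hx, ← Real.exp_add]; simp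
    nlinarith
  rw [le_div_iff₀ ha]
  have h7 : 0 ≤ ∑ s ∈ Icc 1 n, x ^ s := Finset.sum_nonneg fun _ _ => by positivity
  nlinarith

/-- Expand each logarithm as a power series and sum over `s` first: `∑ exp (-(u k s)) ≤ 1/(u k)`, so
the exponent is at most `∑ 1/(u k²) = ζ(2)/u`. -/
lemma prod_inv_one_sub_le {u : ℝ} (hu : 0 < u) (n : ℕ) :
    ∏ s ∈ Icc 1 n, (1 - Real.exp (-(u * s)))⁻¹ ≤ Real.exp (Real.pi ^ 2 / 6 / u) := by
  have hlt : ∀ s ∈ Icc 1 n, Real.exp (-(u * s)) < 1 := by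
    intro s hs
    have : (0 : ℝ) < s := by exact_mod_cast (Finset.mem_Icc.1 hs).1
    rw [← Real.exp_zero]; exact Real.exp_lt_exp.2 (by simp; positivity)
  have h1 : ∀ s ∈ Icc 1 n, (1 - Real.exp (-(u * s)))⁻¹
      = Real.exp (-Real.log (1 - Real.exp (-(u * s)))) := by
    intro s hs
    rw [Real.exp_neg (Real.log _), Real.exp_log (by linarith [hlt s hs])]
  rw [Finset.prod_congr rfl h1, ← Real.exp_sum]
  apply Real.exp_le_exp.2
  have h2 : HasSum (fun k : ℕ => ∑ s ∈ Icc 1 n, Real.exp (-(u * s)) ^ (k + 1) / ((k : ℝ) + 1))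
      (∑ s ∈ Icc 1 n, -Real.log (1 - Real.exp (-(u * s)))) :=
    hasSum_sum fun s hs => Real.hasSum_pow_div_log_of_abs_lt_one
      (by rw [abs_of_pos (Real.exp_pos _)]; exact hlt s hs)
  have h3 : HasSum (fun k : ℕ => 1 / ((k + 1 : ℕ) : ℝ) ^ 2 / u) (Real.pi ^ 2 / 6 / u) := by
    have := (hasSum_nat_add_iff' (f := fun k : ℕ => 1 / (k : ℝ) ^ 2) 1).2 hasSum_zeta_two
    simp only [Finset.range_one, Finset.sum_singleton, Nat.cast_zero, ne_eq, OfNat.ofNat_ne_zero,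
      not_false_eq_true, zero_pow, div_zero, sub_zero] at this
    exact this.div_const u
  refine hasSum_le (fun k => ?_) h2 h3
  rw [← Finset.sum_div]
  have hk : (0 : ℝ) < ((k + 1 : ℕ) : ℝ) := by positivity
  have h4 := sum_pow_exp_le (show 0 < u * ((k + 1 : ℕ) : ℝ) by positivity) n
  have h5 : ∑ s ∈ Icc 1 n, Real.exp (-(u * s)) ^ (k + 1)
      = ∑ s ∈ Icc 1 n, Real.exp (-(u * ((k + 1 : ℕ) : ℝ))) ^ s := by
    refine Finset.sum_congr rfl fun s _ => ?_
    rw [← Real.exp_nat_mul, ← Real.exp_nat_mul]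
    congr 1; ring
  rw [h5]
  calc _ ≤ 1 / (u * ((k + 1 : ℕ) : ℝ)) / ((k : ℝ) + 1) := by gcongr
    _ = _ := by push_cast; field_simp

lemma sum_prod_mult_le (n : ℕ) (f : ℕ → ℕ → ℝ) (hf : ∀ s j, 0 ≤ f s j) :
    ∑ lam : n.Partition, ∏ s ∈ Icc 1 n, f s (mult lam s)
      ≤ ∏ s ∈ Icc 1 n, ∑ j ∈ range (n + 1), f s j := by
  classical
  rw [Finset.prod_sum]
  let φ : n.Partition → (∀ s ∈ Icc 1 n, ℕ) := fun lam s _ => mult lam s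
  have hφ : Function.Injective φ := by
    intro x y hxy
    apply mult_injective
    funext s
    by_cases hs : s ∈ Icc 1 n
    · exact congrFun (congrFun hxy s) hs
    · rw [mult_eq_zero x hs, mult_eq_zero y hs]
  have h1 : ∑ lam : n.Partition, ∏ s ∈ Icc 1 n, f s (mult lam s)
      = ∑ p ∈ univ.image φ, ∏ s ∈ (Icc 1 n).attach, f s (p s s.2) := by
    rw [Finset.sum_image (fun _ _ _ _ h => hφ h)]
    refine Finset.sum_congr rfl fun lam _ => ?_
    exact (Finset.prod_attach (Icc 1 n) (fun s => f s (mult lam s))).symm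
  rw [h1]
  refine Finset.sum_le_sum_of_subset_of_nonneg ?_ fun _ _ _ => Finset.prod_nonneg fun _ _ => hf _ _
  intro p hp
  obtain ⟨lam, -, rfl⟩ := Finset.mem_image.1 hp
  exact Finset.mem_pi.2 fun s _ => Finset.mem_range.2 (Nat.lt_succ_of_le (mult_le lam s))

/-- The Boltzmann weight `∏ exp (-(u s m_s))` is the constant `exp (-(u n))` on partitions of `n`.
Dropping the constraint on the sum leaves a product of geometric expectations times the Euler
product. -/
lemma sum_prod_mult_le_exp {n : ℕ} (hn : 0 < n) (f : ℕ → ℕ → ℝ) (F : ℕ → ℝ)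
    (hf : ∀ s j, 0 ≤ f s j)
    (hF : ∀ s ∈ Icc 1 n, (1 - Real.exp (-(rate n * s))) *
      ∑ j ∈ range (n + 1), f s j * Real.exp (-(rate n * s)) ^ j ≤ F s) :
    ∑ lam : n.Partition, ∏ s ∈ Icc 1 n, f s (mult lam s)
      ≤ Real.exp (2 * (rate n * n)) * ∏ s ∈ Icc 1 n, F s := by
  have hu := rate_pos hn
  have hlt : ∀ s ∈ Icc 1 n, 0 < 1 - Real.exp (-(rate n * s)) := by
    intro s hs
    have : (0 : ℝ) < s := by exact_mod_cast (Finset.mem_Icc.1 hs).1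
    rw [sub_pos, ← Real.exp_zero]; exact Real.exp_lt_exp.2 (by simp; positivity)
  have h1 : ∀ lam : n.Partition, ∏ s ∈ Icc 1 n, Real.exp (-(rate n * s)) ^ mult lam s
      = Real.exp (-(rate n * n)) := by
    intro lam
    simp_rw [← Real.exp_nat_mul]
    rw [← Real.exp_sum]
    congr 1
    have : (∑ s ∈ Icc 1 n, (s : ℝ) * mult lam s) = n := by exact_mod_cast sum_mul_mult lam
    rw [← this, Finset.mul_sum, ← Finset.sum_neg_distrib]
    exact Finset.sum_congr rfl fun s _ => by ring
  have h2 := sum_prod_mult_le n (fun s j => f s j * Real.exp (-(rate n * s)) ^ j)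
    (fun s j => mul_nonneg (hf s j) (by positivity))
  simp_rw [Finset.prod_mul_distrib, h1] at h2
  rw [← Finset.sum_mul] at h2
  have h3 : ∏ s ∈ Icc 1 n, ∑ j ∈ range (n + 1), f s j * Real.exp (-(rate n * s)) ^ j
      ≤ ∏ s ∈ Icc 1 n, (F s * (1 - Real.exp (-(rate n * s)))⁻¹) := by
    refine Finset.prod_le_prod
      (fun s _ => Finset.sum_nonneg fun j _ => mul_nonneg (hf s j) (by positivity)) fun s hs => ?_
    rw [← div_eq_mul_inv, le_div_iff₀ (hlt s hs), mul_comm]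
    exact hF s hs
  have hF0 : 0 ≤ ∏ s ∈ Icc 1 n, F s := by
    refine Finset.prod_nonneg fun s hs => le_trans ?_ (hF s hs)
    exact mul_nonneg (hlt s hs).le
      (Finset.sum_nonneg fun j _ => mul_nonneg (hf s j) (by positivity))
  rw [Finset.prod_mul_distrib] at h3
  have h4 := prod_inv_one_sub_le hu n
  -- The choice of `rate` balances the Euler product against the Boltzmann weight; each contributes
  -- `exp (rate n * n)`.
  have h5 : Real.pi ^ 2 / 6 / rate n = rate n * n := by
    rw [← rate_sq_mul hn]; field_simp
  rw [h5] at h4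
  have h6 := h2.trans (h3.trans (mul_le_mul_of_nonneg_left h4 hF0))
  calc _ = ((∑ lam : n.Partition, ∏ s ∈ Icc 1 n, f s (mult lam s)) * Real.exp (-(rate n * n)))
        * Real.exp (rate n * n) := by
        rw [mul_assoc, ← Real.exp_add]; simp
    _ ≤ ((∏ s ∈ Icc 1 n, F s) * Real.exp (rate n * n)) * Real.exp (rate n * n) := by gcongr
    _ = _ := by rw [mul_assoc, ← Real.exp_add]; ring_nf

/-- Up to a polynomial factor, expectations of products over uniform partitions are bounded by
those over independent geometric multiplicities. -/
theorem exists_sum_prod_mult_le : ∃ C : ℕ, ∃ B : ℝ, 0 < B ∧ ∀ n : ℕ, 0 < n →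
    ∀ (f : ℕ → ℕ → ℝ) (F : ℕ → ℝ), (∀ s j, 0 ≤ f s j) →
    (∀ s ∈ Icc 1 n, (1 - Real.exp (-(rate n * s))) *
      ∑ j ∈ range (n + 1), f s j * Real.exp (-(rate n * s)) ^ j ≤ F s) →
    ∑ lam : n.Partition, ∏ s ∈ Icc 1 n, f s (mult lam s)
      ≤ B * ((n : ℝ) + 1) ^ C * numPart n * ∏ s ∈ Icc 1 n, F s := by
  obtain ⟨C, c, hc, h⟩ := exists_exp_le_numPart
  refine ⟨C, c⁻¹, inv_pos.2 hc, fun n hn f F hf hF => ?_⟩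
  have hF0 : 0 ≤ ∏ s ∈ Icc 1 n, F s := by
    refine Finset.prod_nonneg fun s hs => le_trans ?_ (hF s hs)
    refine mul_nonneg ?_ (Finset.sum_nonneg fun j _ => mul_nonneg (hf s j) (by positivity))
    rw [sub_nonneg, ← Real.exp_zero]
    have := rate_pos hn
    exact Real.exp_le_exp.2 (by simp; positivity)
  refine (sum_prod_mult_le_exp hn f F hf hF).trans (mul_le_mul_of_nonneg_right ?_ hF0)
  rw [mul_assoc, ← div_eq_inv_mul, le_div_iff₀ hc]
  linarith [h n]

/-! ### Exponential moments of truncated sums -/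

lemma sum_range_exp_mul_pow_le {c x : ℝ} (h : c < x) (n : ℕ) :
    ∑ j ∈ range (n + 1), Real.exp (c * j) * Real.exp (-x) ^ j ≤ (1 - Real.exp (-(x - c)))⁻¹ := by
  have h1 : Real.exp (-(x - c)) < 1 := by
    rw [← Real.exp_zero]; exact Real.exp_lt_exp.2 (by linarith)
  have h2 : ∀ j ∈ range (n + 1), Real.exp (c * j) * Real.exp (-x) ^ j
      = Real.exp (-(x - c)) ^ j := by
    intro j _
    rw [← Real.exp_nat_mul, ← Real.exp_nat_mul, ← Real.exp_add]
    congr 1; ring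
  rw [Finset.sum_congr rfl h2, ← tsum_geometric_of_lt_one (Real.exp_pos _).le h1]
  exact Summable.sum_le_tsum _ (fun _ _ => by positivity)
    (summable_geometric_of_lt_one (Real.exp_pos _).le h1)

/-- Tilting one geometric variable by `c` and another by `-c` cancels the first-order term, so only
the variance scale `c² / x²` remains. -/
lemma geometric_mgf_mul_le {c x y : ℝ} (hx : 0 < x) (hc : c ^ 2 ≤ 1) (hy : y ≤ 1 / 2)
    (hcy : 2 * c ^ 2 ≤ y * x ^ 2) (hcx : |c| < x) :
    (1 - Real.exp (-x)) * (1 - Real.exp (-(x - c)))⁻¹ *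
      ((1 - Real.exp (-x)) * (1 - Real.exp (-(x + c)))⁻¹) ≤ Real.exp (2 * y) := by
  obtain ⟨hc1, hc2⟩ := abs_lt.1 hcx
  have hlt : ∀ z : ℝ, 0 < z → 0 < 1 - Real.exp (-z) := fun z hz => by
    rw [sub_pos, ← Real.exp_zero]; exact Real.exp_lt_exp.2 (by linarith)
  have h1 := hlt x hx
  have h2 := hlt (x - c) (by linarith)
  have h3 := hlt (x + c) (by linarith)
  have h4 : (1 - Real.exp (-(x - c))) * (1 - Real.exp (-(x + c)))
      = (1 - Real.exp (-x)) ^ 2 - Real.exp (-x) * (2 * (Real.cosh c - 1)) := by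
    rw [Real.cosh_eq, show -(x - c) = -x + c by ring, show -(x + c) = -x + -c by ring,
      Real.exp_add, Real.exp_add]
    have : Real.exp c * Real.exp (-c) = 1 := by rw [← Real.exp_add]; simp
    linear_combination Real.exp (-x) ^ 2 * this
  have h5 : 2 * (Real.cosh c - 1) ≤ 2 * c ^ 2 := by
    have e1 := Real.cosh_le_exp_half_sq c
    have e2 : Real.exp (c ^ 2 / 2) * (1 - c ^ 2 / 2) ≤ 1 := by
      have := Real.one_sub_le_exp_neg (c ^ 2 / 2)
      calc _ ≤ Real.exp (c ^ 2 / 2) * Real.exp (-(c ^ 2 / 2)) := by gcongr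
        _ = 1 := by rw [← Real.exp_add]; simp
    have e3 : Real.cosh c * (1 - c ^ 2 / 2) ≤ 1 :=
      le_trans (mul_le_mul_of_nonneg_right e1 (by linarith)) e2
    nlinarith [sq_nonneg c]
  have h6 : Real.exp (-x) * x ^ 2 ≤ (1 - Real.exp (-x)) ^ 2 := by
    rw [one_sub_exp_sq]
    exact mul_le_mul_of_nonneg_left (sq_le_two_mul_cosh x) (Real.exp_pos _).le
  have hy0 : 0 ≤ y := by
    by_contra hcon
    push Not at hcon
    nlinarith [sq_nonneg c, mul_pos hx hx]
  have h7 : (1 - Real.exp (-x)) ^ 2 * (1 - y)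
      ≤ (1 - Real.exp (-(x - c))) * (1 - Real.exp (-(x + c))) := by
    rw [h4]
    have : Real.exp (-x) * (2 * (Real.cosh c - 1)) ≤ y * (Real.exp (-x) * x ^ 2) := by
      calc _ ≤ Real.exp (-x) * (y * x ^ 2) :=
            mul_le_mul_of_nonneg_left (h5.trans hcy) (Real.exp_pos _).le
        _ = _ := by ring
    nlinarith
  have h8 : 1 ≤ Real.exp (2 * y) * (1 - y) := by
    have := Real.add_one_le_exp (2 * y)
    nlinarith
  have e : (1 - Real.exp (-x)) * (1 - Real.exp (-(x - c)))⁻¹ *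
      ((1 - Real.exp (-x)) * (1 - Real.exp (-(x + c)))⁻¹)
      = (1 - Real.exp (-x)) ^ 2 / ((1 - Real.exp (-(x - c))) * (1 - Real.exp (-(x + c)))) := by
    field_simp
  rw [e, div_le_iff₀ (by positivity)]
  calc (1 - Real.exp (-x)) ^ 2 ≤ (1 - Real.exp (-x)) ^ 2 * (Real.exp (2 * y) * (1 - y)) :=
        le_mul_of_one_le_right (by positivity) h8
    _ = Real.exp (2 * y) * ((1 - Real.exp (-x)) ^ 2 * (1 - y)) := by ring
    _ ≤ _ := by gcongr

lemma prod_exp_inv_le {n : ℕ} (hn : 0 < n) : ∏ s ∈ Icc 1 n, Real.exp (1 / (s : ℝ)) ≤ 3 * n := by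
  have hn' : (0 : ℝ) < n := by exact_mod_cast hn
  rw [← Real.exp_sum]
  have h := harmonic_le_one_add_log n
  rw [harmonic_eq_sum_Icc] at h
  push_cast at h
  simp only [one_div]
  calc _ ≤ Real.exp (1 + Real.log n) := Real.exp_le_exp.2 h
    _ = Real.exp 1 * n := by rw [Real.exp_add, Real.exp_log hn']
    _ ≤ 3 * n := by gcongr; linarith [Real.exp_one_lt_d9]

/-- The bound on `c s` makes the factor at `s` at most `exp (1/s)`, and the harmonic sum keeps the
whole product linear in `n`. Opposite tilts on the two partitions are what a discrepancy requires.
-/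
theorem exists_mgf_mul_le : ∃ C : ℕ, ∃ B : ℝ, 0 < B ∧ ∀ n : ℕ, 0 < n → ∀ c : ℕ → ℝ,
    (∀ s ∈ Icc 1 n, |c s| ≤ √s / (2 * √n)) →
    (∑ lam : n.Partition, Real.exp (∑ s ∈ Icc 1 n, c s * mult lam s)) *
      (∑ mu : n.Partition, Real.exp (-∑ s ∈ Icc 1 n, c s * mult mu s))
      ≤ B * ((n : ℝ) + 1) ^ C * (numPart n : ℝ) ^ 2 := by
  obtain ⟨C, B, hB, h⟩ := exists_sum_prod_mult_le
  refine ⟨2 * C + 1, 3 * B ^ 2, by positivity, fun n hn c hc => ?_⟩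
  have hn' : (0 : ℝ) < n := by exact_mod_cast hn
  have hu := rate_pos hn
  have hZ := rate_sq_mul hn
  set u := rate n
  have hZ1 : 1 ≤ u ^ 2 * n := by rw [hZ]; nlinarith [Real.pi_gt_three]
  have hcs : ∀ s ∈ Icc 1 n, (c s) ^ 2 ≤ s / (4 * n) := by
    intro s hs
    have := pow_le_pow_left₀ (abs_nonneg _) (hc s hs) 2
    rw [sq_abs, div_pow, mul_pow, Real.sq_sqrt (by positivity), Real.sq_sqrt hn'.le] at this
    linarith
  have hpos : ∀ s ∈ Icc 1 n, (1 : ℝ) ≤ s := fun s hs => by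
    exact_mod_cast (Finset.mem_Icc.1 hs).1
  have hle : ∀ s ∈ Icc 1 n, (s : ℝ) ≤ n := fun s hs => by
    exact_mod_cast (Finset.mem_Icc.1 hs).2
  have hcx : ∀ s ∈ Icc 1 n, |c s| < u * s := by
    intro s hs
    have h1 := hpos s hs
    have : (c s) ^ 2 < (u * s) ^ 2 := by
      refine lt_of_le_of_lt (hcs s hs) ?_
      rw [div_lt_iff₀ (by positivity)]
      have : (1 : ℝ) * s ≤ (u ^ 2 * n) * s := by gcongr
      nlinarith
    exact abs_lt.2 (abs_lt_of_sq_lt_sq' this (by positivity))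
  have key : ∀ d : ℕ → ℝ, (∀ s ∈ Icc 1 n, |d s| < u * s) →
      ∑ lam : n.Partition, Real.exp (∑ s ∈ Icc 1 n, d s * mult lam s)
        ≤ B * ((n : ℝ) + 1) ^ C * numPart n *
          ∏ s ∈ Icc 1 n, ((1 - Real.exp (-(u * s))) * (1 - Real.exp (-(u * s - d s)))⁻¹) := by
    intro d hd
    simp_rw [Real.exp_sum]
    refine h n hn (fun s j => Real.exp (d s * j)) _ (fun _ _ => (Real.exp_pos _).le) ?_
    intro s hs
    have : 0 ≤ 1 - Real.exp (-(u * s)) := by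
      rw [sub_nonneg, ← Real.exp_zero]; exact Real.exp_le_exp.2 (by simp; positivity)
    exact mul_le_mul_of_nonneg_left
      (sum_range_exp_mul_pow_le (lt_of_le_of_lt (le_abs_self _) (hd s hs)) n) this
  have k1 := key c hcx
  have k2 := key (fun s => -c s) (by simpa using hcx)
  simp only [neg_mul, Finset.sum_neg_distrib] at k2
  have k3 := mul_le_mul k1 k2 (Finset.sum_nonneg fun _ _ => (Real.exp_pos _).le)
    (le_trans (Finset.sum_nonneg fun _ _ => (Real.exp_pos _).le) k1)
  refine k3.trans ?_
  have k4 : (∏ s ∈ Icc 1 n, ((1 - Real.exp (-(u * s))) * (1 - Real.exp (-(u * s - c s)))⁻¹)) *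
      ∏ s ∈ Icc 1 n, ((1 - Real.exp (-(u * s))) * (1 - Real.exp (-(u * s - -c s)))⁻¹) ≤ 3 * n := by
    rw [← Finset.prod_mul_distrib]
    refine le_trans (Finset.prod_le_prod ?_ ?_) (prod_exp_inv_le hn)
    · intro s hs
      obtain ⟨a1, a2⟩ := abs_lt.1 (hcx s hs)
      have hnn : ∀ z : ℝ, 0 ≤ z → 0 ≤ 1 - Real.exp (-z) := fun z hz => by
        rw [sub_nonneg, ← Real.exp_zero]; exact Real.exp_le_exp.2 (by linarith)
      have b1 := hnn (u * s) (by positivity)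
      have b2 := hnn (u * s - c s) (by linarith)
      have b3 := hnn (u * s - -c s) (by linarith)
      positivity
    · intro s hs
      have h1 := hpos s hs
      have h2 := hcs s hs
      have := geometric_mgf_mul_le (c := c s) (x := u * s) (y := 1 / (2 * s)) (by positivity)
        (h2.trans ((div_le_one (by positivity)).2 (by linarith [hle s hs])))
        (by rw [div_le_div_iff₀ (by positivity) (by positivity)]; linarith)
        (by
          calc 2 * c s ^ 2 ≤ 2 * (s / (4 * n)) := by gcongr
            _ = 1 / (2 * n) * s := by field_simp; norm_num
            _ ≤ (u ^ 2 * n) * (1 / (2 * n) * s) := le_mul_of_one_le_left (by positivity) hZ1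
            _ = _ := by field_simp) (hcx s hs)
      rw [sub_neg_eq_add]
      refine this.trans (le_of_eq ?_)
      congr 1
      field_simp
  rw [mul_mul_mul_comm, ← sq]
  calc _ ≤ (B * ((n : ℝ) + 1) ^ C * numPart n) ^ 2 * (3 * n) := by gcongr
    _ ≤ (B * ((n : ℝ) + 1) ^ C * numPart n) ^ 2 * (3 * (n + 1)) := by gcongr; linarith
    _ = _ := by ring

/-! ### Truncated part sums and dominance -/

/-- The sum of the parts of `lam`, each truncated at `t`. -/
def capSum {n : ℕ} (lam : n.Partition) (t : ℕ) : ℕ := ∑ s ∈ Icc 1 n, min s t * mult lam s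

/-- Take `i` to be the number of entries exceeding `t`; monotonicity puts them first. -/
lemma exists_sum_sub_le (t : ℕ) : ∀ l : List ℕ, l.Pairwise (· ≥ ·) →
    ∃ i, (l.map (· - t)).sum + i * t ≤ ∑ j ∈ range i, l.getD j 0
  | [], _ => ⟨0, by simp⟩
  | a :: l, h => by
    obtain ⟨h1, h2⟩ := List.pairwise_cons.1 h
    rcases le_or_gt a t with ha | ha
    · refine ⟨0, ?_⟩
      have : ∀ x ∈ (a :: l).map (· - t), x = 0 := by
        intro x hx
        obtain ⟨y, hy, rfl⟩ := List.mem_map.1 hx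
        rcases List.mem_cons.1 hy with rfl | hy
        · omega
        · have := h1 y hy
          omega
      rw [List.sum_eq_zero this]
      simp
    · obtain ⟨i, hi⟩ := exists_sum_sub_le t l h2
      refine ⟨i + 1, ?_⟩
      rw [Finset.sum_range_succ']
      simp only [List.map_cons, List.sum_cons, List.getD_cons_succ, List.getD_cons_zero, add_mul]
      omega

lemma sum_getD_le (t : ℕ) : ∀ (l : List ℕ) (i : ℕ),
    ∑ j ∈ range i, l.getD j 0 ≤ (l.map (· - t)).sum + i * t
  | [], i => by simp
  | a :: l, 0 => by simp
  | a :: l, i + 1 => by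
    have := sum_getD_le t l i
    rw [Finset.sum_range_succ']
    simp only [List.map_cons, List.sum_cons, List.getD_cons_succ, List.getD_cons_zero, add_mul]
    omega

lemma capSum_add_sum_sub {n : ℕ} (lam : n.Partition) (t : ℕ) :
    capSum lam t + ((lam.parts.sort (· ≥ ·)).map (· - t)).sum = n := by
  have h1 : ((lam.parts.sort (· ≥ ·)).map (· - t)).sum = ∑ s ∈ Icc 1 n, (s - t) * mult lam s := by
    rw [← sum_map_eq lam (fun s => s - t), ← Multiset.sum_coe, ← Multiset.map_coe,
      Multiset.sort_eq]
  rw [h1, capSum, ← Finset.sum_add_distrib]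
  conv_rhs => rw [← sum_mul_mult lam]
  refine Finset.sum_congr rfl fun s _ => ?_
  rw [← add_mul]
  congr 1
  omega

/-- Legendre duality: the total excess of the parts over `t` is the maximum over `i` of the `i`-th
partial sum minus `i t`, hence monotone in the dominance order; the truncated sum is `n` minus the
excess. -/
lemma DominatedBy.capSum_le {n : ℕ} {lam mu : n.Partition} (h : DominatedBy lam mu) (t : ℕ) :
    capSum mu t ≤ capSum lam t := by
  obtain ⟨i, hi⟩ := exists_sum_sub_le t (lam.parts.sort (· ≥ ·))
    (Multiset.pairwise_sort lam.parts (· ≥ ·))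
  have h1 := h i
  simp only [part] at h1
  have h2 := sum_getD_le t (mu.parts.sort (· ≥ ·)) i
  have h3 := capSum_add_sum_sub lam t
  have h4 := capSum_add_sum_sub mu t
  omega

/-! ### Exponential moments of the discrepancies -/

/-- The terms decay geometrically on both sides of `4 ^ (i + k) ≈ √s`. The proof dominates them by
differences of `z / (√s + z)` along `z = 4 ^ (i + k)`, which telescope, so the bound is uniform in
`i` and `K`. -/
lemma sum_min_div_le {s : ℝ} (hs : 0 < s) (i K : ℕ) :
    ∑ k ∈ range K, min s ((16 : ℝ) ^ (i + k)) / 4 ^ (i + k) ≤ 10 / 3 * √s := by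
  set a := √s with ha
  have ha0 : 0 < a := Real.sqrt_pos.2 hs
  have has : s = a ^ 2 := (Real.sq_sqrt hs.le).symm
  have hterm : ∀ k, min s ((16 : ℝ) ^ (i + k)) / 4 ^ (i + k)
      ≤ 10 / 3 * a * ((4 : ℝ) ^ (i + (k + 1)) / (a + 4 ^ (i + (k + 1)))
        - (4 : ℝ) ^ (i + k) / (a + 4 ^ (i + k))) := by
    intro k
    have h16 : (16 : ℝ) ^ (i + k) = (4 ^ (i + k)) ^ 2 := by
      rw [← pow_mul, mul_comm, pow_mul]; norm_num
    rw [h16, has, show i + (k + 1) = (i + k) + 1 by ring, pow_succ (4 : ℝ)]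
    set z : ℝ := 4 ^ (i + k)
    have hz : 0 < z := by positivity
    have e : 10 / 3 * a * (z * 4 / (a + z * 4) - z / (a + z))
        = 10 * a ^ 2 * z / ((a + z * 4) * (a + z)) := by
      field_simp; ring
    rw [e, div_le_div_iff₀ hz (by positivity)]
    rcases le_total a z with h | h
    · have : min (a ^ 2) (z ^ 2) ≤ a ^ 2 := min_le_left _ _
      calc _ ≤ a ^ 2 * ((a + z * 4) * (a + z)) := by gcongr
        _ ≤ a ^ 2 * ((z + z * 4) * (z + z)) := by gcongr
        _ = _ := by ring
    · have : min (a ^ 2) (z ^ 2) ≤ z ^ 2 := min_le_right _ _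
      calc _ ≤ z ^ 2 * ((a + z * 4) * (a + z)) := by gcongr
        _ ≤ z ^ 2 * ((a + a * 4) * (a + a)) := by gcongr
        _ = _ := by ring
  refine (Finset.sum_le_sum fun k _ => hterm k).trans ?_
  rw [← Finset.mul_sum, Finset.sum_range_sub (fun k => (4 : ℝ) ^ (i + k) / (a + 4 ^ (i + k)))]
  have h1 : (4 : ℝ) ^ (i + K) / (a + 4 ^ (i + K)) ≤ 1 :=
    (div_le_one (by positivity)).2 (by linarith)
  have h2 : 0 ≤ (4 : ℝ) ^ (i + 0) / (a + 4 ^ (i + 0)) := by positivity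
  have : 0 ≤ 10 / 3 * a := by positivity
  nlinarith

/-- The discrepancy of two partitions at truncation level `t`. -/
noncomputable def disc {n : ℕ} (lam mu : n.Partition) (t : ℕ) : ℝ := capSum lam t - capSum mu t

lemma disc_eq {n : ℕ} (lam mu : n.Partition) (t : ℕ) :
    disc lam mu t = ∑ s ∈ Icc 1 n, ((min s t : ℕ) : ℝ) * mult lam s
      - ∑ s ∈ Icc 1 n, ((min s t : ℕ) : ℝ) * mult mu s := by
  simp [disc, capSum]

lemma exp_abs_le (x : ℝ) : Real.exp |x| ≤ ∑ b : Bool, Real.exp ((if b then 1 else -1) * x) := by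
  rw [Fintype.sum_bool]
  simp only [if_true, one_mul, Bool.false_eq_true, if_false, neg_mul]
  rcases abs_choice x with h | h <;> rw [h]
  · linarith [Real.exp_pos (-x)]
  · linarith [Real.exp_pos x]

/-- Replace each absolute value by a choice of sign, at the cost of `2 ^ K` patterns. For each
pattern the exponent is linear in the multiplicities, with coefficients at most `√s / (3 √n)` by
`sum_min_div_le`, so `exists_mgf_mul_le` applies. -/
theorem exists_sum_exp_disc_le : ∃ C : ℕ, ∃ B : ℝ, 0 < B ∧ ∀ n : ℕ, 0 < n → ∀ i K : ℕ,
    ∑ lam : n.Partition, ∑ mu : n.Partition,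
      Real.exp (∑ k : Fin K, |1 / (20 * √n) / 4 ^ (i + k) * disc lam mu (2 * 16 ^ (i + k))|)
      ≤ 2 ^ K * (B * ((n : ℝ) + 1) ^ C * (numPart n : ℝ) ^ 2) := by
  obtain ⟨C, B, hB, h⟩ := exists_mgf_mul_le
  refine ⟨C, B, hB, fun n hn i K => ?_⟩
  have hn' : (0 : ℝ) < n := by exact_mod_cast hn
  set θ : Fin K → ℝ := fun k => 1 / (20 * √n) / 4 ^ (i + (k : ℕ)) with hθ
  set sg : (Fin K → Bool) → Fin K → ℝ := fun σ k => if σ k then 1 else -1 with hsg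
  set c : (Fin K → Bool) → ℕ → ℝ := fun σ s =>
    ∑ k : Fin K, sg σ k * θ k * ((min s (2 * 16 ^ (i + (k : ℕ))) : ℕ) : ℝ) with hc
  have hcb : ∀ σ, ∀ s ∈ Icc 1 n, |c σ s| ≤ √s / (2 * √n) := by
    intro σ s hs
    have hs0 : (0 : ℝ) < s := by exact_mod_cast (Finset.mem_Icc.1 hs).1
    refine (Finset.abs_sum_le_sum_abs _ _).trans ?_
    have h1 : ∀ k : Fin K, |sg σ k * θ k * ((min s (2 * 16 ^ (i + (k : ℕ))) : ℕ) : ℝ)|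
        ≤ 1 / (10 * √n) * (min (s : ℝ) ((16 : ℝ) ^ (i + (k : ℕ))) / 4 ^ (i + (k : ℕ))) := by
      intro k
      have e1 : |sg σ k| = 1 := by
        simp only [hsg]; split_ifs <;> simp
      have e2 : 0 ≤ θ k := by simp only [hθ]; positivity
      rw [abs_mul, abs_mul, e1, one_mul, abs_of_nonneg e2, Nat.abs_cast, Nat.cast_min]
      push_cast
      have e3 : min (s : ℝ) (2 * 16 ^ (i + (k : ℕ))) ≤ 2 * min (s : ℝ) ((16 : ℝ) ^ (i + (k : ℕ))) := by
        rw [mul_min_of_nonneg _ _ (by norm_num : (0 : ℝ) ≤ 2)]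
        exact min_le_min (by linarith) le_rfl
      calc _ ≤ θ k * (2 * min (s : ℝ) ((16 : ℝ) ^ (i + (k : ℕ)))) := by gcongr
        _ = _ := by simp only [hθ]; field_simp; norm_num
    refine (Finset.sum_le_sum fun k _ => h1 k).trans ?_
    rw [← Finset.mul_sum, Fin.sum_univ_eq_sum_range
      (fun k => min (s : ℝ) ((16 : ℝ) ^ (i + k)) / 4 ^ (i + k)) K]
    calc _ ≤ 1 / (10 * √n) * (10 / 3 * √s) := by
          gcongr; exact sum_min_div_le hs0 i K
      _ = 2 / 3 * (√s / (2 * √n)) := by field_simp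
      _ ≤ _ := by
          have : 0 ≤ √(s : ℝ) / (2 * √n) := by positivity
          linarith
  have hlin : ∀ (σ : Fin K → Bool) (lam mu : n.Partition),
      ∑ k : Fin K, sg σ k * (θ k * disc lam mu (2 * 16 ^ (i + (k : ℕ))))
        = ∑ s ∈ Icc 1 n, c σ s * mult lam s + -∑ s ∈ Icc 1 n, c σ s * mult mu s := by
    intro σ lam mu
    have e : ∀ nu : n.Partition, ∑ s ∈ Icc 1 n, c σ s * mult nu s
        = ∑ k : Fin K, sg σ k * θ k * ∑ s ∈ Icc 1 n,
          ((min s (2 * 16 ^ (i + (k : ℕ))) : ℕ) : ℝ) * mult nu s := by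
      intro nu
      simp only [hc, Finset.sum_mul, Finset.mul_sum]
      rw [Finset.sum_comm]
      exact Finset.sum_congr rfl fun _ _ => Finset.sum_congr rfl fun _ _ => by ring
    rw [e, e, ← sub_eq_add_neg, ← Finset.sum_sub_distrib]
    refine Finset.sum_congr rfl fun k _ => ?_
    rw [disc_eq]; ring
  have hpt : ∀ lam mu : n.Partition,
      Real.exp (∑ k : Fin K, |θ k * disc lam mu (2 * 16 ^ (i + (k : ℕ)))|)
        ≤ ∑ σ : Fin K → Bool, Real.exp (∑ s ∈ Icc 1 n, c σ s * mult lam s)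
          * Real.exp (-∑ s ∈ Icc 1 n, c σ s * mult mu s) := by
    intro lam mu
    rw [Real.exp_sum]
    refine (Finset.prod_le_prod (fun _ _ => (Real.exp_pos _).le) fun k _ => exp_abs_le _).trans ?_
    rw [Finset.prod_univ_sum, Fintype.piFinset_univ]
    refine le_of_eq (Finset.sum_congr rfl fun σ _ => ?_)
    rw [← Real.exp_sum, ← Real.exp_add, ← hlin]
  calc _ ≤ ∑ lam : n.Partition, ∑ mu : n.Partition, ∑ σ : Fin K → Bool,
        Real.exp (∑ s ∈ Icc 1 n, c σ s * mult lam s)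
          * Real.exp (-∑ s ∈ Icc 1 n, c σ s * mult mu s) :=
        Finset.sum_le_sum fun lam _ => Finset.sum_le_sum fun mu _ => hpt lam mu
    _ = ∑ σ : Fin K → Bool, (∑ lam : n.Partition, Real.exp (∑ s ∈ Icc 1 n, c σ s * mult lam s)) *
          (∑ mu : n.Partition, Real.exp (-∑ s ∈ Icc 1 n, c σ s * mult mu s)) := by
        simp_rw [Finset.sum_mul_sum]
        rw [Finset.sum_comm (s := (univ : Finset (Fin K → Bool)))]
        exact Finset.sum_congr rfl fun lam _ => Finset.sum_comm
    _ ≤ ∑ σ : Fin K → Bool, B * ((n : ℝ) + 1) ^ C * (numPart n : ℝ) ^ 2 :=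
        Finset.sum_le_sum fun σ _ => h n hn (c σ) (hcb σ)
    _ = _ := by simp

/-! ### Few small multiplicities -/

lemma rate_le_div {n : ℕ} : rate n ≤ 1.3 / √n := by
  rw [rate_eq]
  gcongr
  rw [div_le_iff₀ (by positivity)]
  have h1 : (2.44 : ℝ) ≤ √6 := by
    apply Real.le_sqrt_of_sq_le; norm_num
  nlinarith [Real.pi_lt_d2]

lemma exp_eight_le : Real.exp 8 ≤ 3000 := by
  have h := Real.exp_one_lt_d9
  have : Real.exp 8 = Real.exp 1 ^ 8 := by rw [← Real.exp_nat_mul]; norm_num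
  rw [this]
  calc Real.exp 1 ^ 8 ≤ 2.7182818286 ^ 8 := by gcongr
    _ ≤ 3000 := by norm_num

/-- A Chernoff bound with weight `exp 8` on every short multiplicity. A geometric multiplicity at `s
≤ 4r` is below `b` with probability at most `4 u r b`, so each of the `3r` sites costs at most `exp
(1/3)`, in total `exp r`, while a bad partition has weight at least `exp (2r)`. -/
theorem exists_card_small_mult_le : ∃ C : ℕ, ∃ B : ℝ, 0 < B ∧ ∀ n : ℕ, 0 < n → ∀ r b : ℕ, 4 * r ≤ n →
    50000 * ((r : ℝ) * b) ≤ √n →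
    (#{lam : n.Partition | r < 4 * #{s ∈ Ioc r (4 * r) | mult lam s < b}} : ℝ)
      ≤ B * ((n : ℝ) + 1) ^ C * numPart n * Real.exp (-r) := by
  obtain ⟨C, B, hB, h⟩ := exists_sum_prod_mult_le
  refine ⟨C, B, hB, fun n hn r b h4r hrb => ?_⟩
  have hn' : (0 : ℝ) < n := by exact_mod_cast hn
  have hu := rate_pos hn
  set u := rate n
  have h8 := exp_eight_le
  have hurb : u * (r * b) ≤ 1.3 / 50000 := by
    have h1 : u ≤ 1.3 / √n := rate_le_div
    calc u * (r * b) ≤ 1.3 / √n * (√n / 50000) := by gcongr; linarith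
      _ = _ := by field_simp
  set f : ℕ → ℕ → ℝ := fun s j => if s ∈ Ioc r (4 * r) ∧ j < b then Real.exp 8 else 1 with hf
  set F : ℕ → ℝ := fun s => if s ∈ Ioc r (4 * r) then Real.exp (1 / 3) else 1 with hF
  have hf0 : ∀ s j, 0 ≤ f s j := by
    intro s j; simp only [hf]; split_ifs <;> positivity
  have hf1 : ∀ s j, 1 ≤ f s j := by
    intro s j; simp only [hf]; split_ifs
    · exact Real.one_le_exp (by norm_num)
    · exact le_rfl
  have main := h n hn f F hf0 (by
    intro s hs
    have hs0 : (1 : ℝ) ≤ s := by exact_mod_cast (Finset.mem_Icc.1 hs).1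
    set Q := Real.exp (-(u * s)) with hQ
    have hQ0 : 0 < Q := Real.exp_pos _
    have hQ1 : Q < 1 := by
      rw [hQ, ← Real.exp_zero]; exact Real.exp_lt_exp.2 (by simp; positivity)
    have hQ2 : 1 - Q ≤ u * s := by linarith [Real.one_sub_le_exp_neg (u * s)]
    have hgeo : (1 - Q) * ∑ j ∈ range (n + 1), Q ^ j ≤ 1 := by
      have := geom_sum_mul_neg Q (n + 1)
      rw [mul_comm, this]
      linarith [pow_pos hQ0 (n + 1)]
    by_cases hsr : s ∈ Ioc r (4 * r)
    · have hs4r : (s : ℝ) ≤ 4 * r := by exact_mod_cast (Finset.mem_Ioc.1 hsr).2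
      have e1 : ∑ j ∈ range (n + 1), f s j * Q ^ j
          ≤ ∑ j ∈ range (n + 1), Q ^ j + Real.exp 8 * b := by
        have e2 : ∀ j ∈ range (n + 1), f s j * Q ^ j
            ≤ Q ^ j + if j < b then Real.exp 8 else 0 := by
          intro j _
          have e3 : Q ^ j ≤ 1 := pow_le_one₀ hQ0.le hQ1.le
          have e4 : 0 < Q ^ j := by positivity
          simp only [hf, hsr, true_and]
          split_ifs
          · nlinarith [Real.exp_pos 8]
          · linarith
        refine (Finset.sum_le_sum e2).trans ?_
        rw [Finset.sum_add_distrib, ← Finset.sum_filter, Finset.sum_const, nsmul_eq_mul, mul_comm]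
        gcongr
        calc _ ≤ #(range b) := Finset.card_le_card (by intro j; simp)
          _ = b := by simp
      simp only [hF, hsr, if_true]
      calc _ ≤ (1 - Q) * (∑ j ∈ range (n + 1), Q ^ j + Real.exp 8 * b) :=
            mul_le_mul_of_nonneg_left e1 (by linarith)
        _ = (1 - Q) * ∑ j ∈ range (n + 1), Q ^ j + (1 - Q) * (Real.exp 8 * b) := by ring
        _ ≤ 1 + (u * (4 * r)) * (3000 * b) := by gcongr; exact hQ2.trans (by gcongr)
        _ ≤ 1 / 3 + 1 := by nlinarith
        _ ≤ _ := Real.add_one_le_exp _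
    · have : ∀ j ∈ range (n + 1), f s j * Q ^ j = Q ^ j := by
        intro j _; simp only [hf, hsr, false_and, if_false, one_mul]
      rw [Finset.sum_congr rfl this]
      simpa only [hF, hsr, if_false] using hgeo)
  have hprodF : ∏ s ∈ Icc 1 n, F s ≤ Real.exp r := by
    simp only [hF]
    rw [Finset.prod_ite, Finset.prod_const, Finset.prod_const_one, mul_one, ← Real.exp_nat_mul]
    apply Real.exp_le_exp.2
    have : #{s ∈ Icc 1 n | s ∈ Ioc r (4 * r)} ≤ 3 * r := by
      calc _ ≤ #(Ioc r (4 * r)) := Finset.card_le_card (by intro s; simp)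
        _ = 3 * r := by simp; omega
    have : ((#{s ∈ Icc 1 n | s ∈ Ioc r (4 * r)} : ℕ) : ℝ) ≤ 3 * r := by exact_mod_cast this
    linarith
  set P : Finset n.Partition := {lam | r < 4 * #{s ∈ Ioc r (4 * r) | mult lam s < b}} with hP
  have hbad : ∀ lam ∈ P, Real.exp (2 * r) ≤ ∏ s ∈ Icc 1 n, f s (mult lam s) := by
    intro lam hlam
    have h1 := (Finset.mem_filter.1 hlam).2
    set S : Finset ℕ := {s ∈ Ioc r (4 * r) | mult lam s < b} with hS
    have hsub : S ⊆ Icc 1 n := by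
      intro s hs
      have := Finset.mem_Ioc.1 (Finset.mem_filter.1 hs).1
      exact Finset.mem_Icc.2 ⟨by omega, by omega⟩
    have h2 : ∏ s ∈ S, f s (mult lam s) = Real.exp (#S * 8) := by
      rw [Real.exp_nat_mul, ← Finset.prod_const]
      refine Finset.prod_congr rfl fun s hs => ?_
      simp only [hf, if_pos (Finset.mem_filter.1 hs)]
    calc Real.exp (2 * r) ≤ Real.exp (#S * 8) := by
          apply Real.exp_le_exp.2
          have : (r : ℝ) ≤ 4 * #S := by exact_mod_cast h1.le
          linarith
      _ = ∏ s ∈ S, f s (mult lam s) := h2.symm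
      _ ≤ _ := Finset.prod_le_prod_of_subset_of_one_le hsub (fun _ _ => hf0 _ _)
          fun _ _ _ => hf1 _ _
  have h3 : (#P : ℝ) * Real.exp (2 * r)
      ≤ ∑ lam : n.Partition, ∏ s ∈ Icc 1 n, f s (mult lam s) := by
    rw [← nsmul_eq_mul]
    exact (Finset.card_nsmul_le_sum P _ _ hbad).trans
      (Finset.sum_le_sum_of_subset_of_nonneg (Finset.subset_univ _)
        fun _ _ _ => Finset.prod_nonneg fun _ _ => hf0 _ _)
  have h4 : (#P : ℝ) * Real.exp (2 * r) ≤ B * ((n : ℝ) + 1) ^ C * numPart n * Real.exp r :=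
    h3.trans (main.trans (by gcongr))
  have e1 : Real.exp (2 * (r : ℝ)) = Real.exp r * Real.exp r := by
    rw [← Real.exp_add]; ring_nf
  rw [Real.exp_neg, ← div_eq_mul_inv, le_div_iff₀ (Real.exp_pos _)]
  rw [e1, ← mul_assoc] at h4
  exact le_of_mul_le_mul_right h4 (Real.exp_pos _)

/-! ### Lower tails of Rademacher sums -/

/-- The sign attached to a Boolean. -/
def sign (b : Bool) : ℝ := if b then 1 else -1

/-- Compares the second moment of `exp (θ * sign)` with the square of the first, as needed for the
Paley–Zygmund argument in `card_signs_ge`. -/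
lemma cosh_two_mul_le (θ : ℝ) : Real.cosh (2 * θ) ≤ Real.exp (θ ^ 2) * Real.cosh θ ^ 2 := by
  have h1 : Real.cosh (2 * θ) = 2 * Real.cosh θ ^ 2 - 1 := by
    rw [Real.cosh_two_mul, Real.sinh_sq]; ring
  have h2 : Real.cosh θ ^ 2 ≤ Real.exp (θ ^ 2) := by
    have := pow_le_pow_left₀ (Real.cosh_pos θ).le (Real.cosh_le_exp_half_sq θ) 2
    rw [← Real.exp_nat_mul] at this
    refine this.trans (le_of_eq ?_)
    congr 1; push_cast; ring
  have h3 := Real.cosh_pos θ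
  rw [h1]
  set E := Real.exp (θ ^ 2)
  set w := Real.cosh θ ^ 2
  have hw : 0 < w := by positivity
  rcases le_total 2 E with h | h
  · nlinarith
  · nlinarith [sq_nonneg (E - 1)]

lemma exp_le_cosh {θ : ℝ} (h : θ ^ 2 ≤ 1) : Real.exp (θ ^ 2 / 4) ≤ Real.cosh θ := by
  have h1 := sq_le_two_mul_cosh θ
  have h2 := Real.one_sub_le_exp_neg (θ ^ 2 / 4)
  have h3 : Real.exp (θ ^ 2 / 4) * Real.exp (-(θ ^ 2 / 4)) = 1 := by rw [← Real.exp_add]; simp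
  have h4 := Real.exp_pos (θ ^ 2 / 4)
  have h5 : Real.exp (θ ^ 2 / 4) * (1 - θ ^ 2 / 4) ≤ 1 :=
    (mul_le_mul_of_nonneg_left h2 h4.le).trans_eq h3
  nlinarith [sq_nonneg θ]

lemma sum_exp_signs {J : Type*} [Fintype J] [DecidableEq J] (s : J → ℝ)
    (hs : ∀ j, s j = 1 ∨ s j = 0 ∨ s j = -1) (θ : ℝ) :
    ∑ e : J → Bool, Real.exp (θ * ∑ j, sign (e j) * s j)
      = 2 ^ Fintype.card J * Real.cosh θ ^ #{j | s j ≠ 0} := by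
  have h1 : ∀ j, ∑ b : Bool, Real.exp (θ * (sign b * s j))
      = 2 * (if s j ≠ 0 then Real.cosh θ else 1) := by
    intro j
    rw [Fintype.sum_bool]
    simp only [sign, if_true, Bool.false_eq_true, if_false]
    rcases hs j with h | h | h <;> rw [h]
    · simp [Real.cosh_eq]; ring
    · norm_num
    · simp [Real.cosh_eq]; ring
  have h2 := Finset.prod_univ_sum (fun _ : J => (univ : Finset Bool))
    (fun j b => Real.exp (θ * (sign b * s j)))
  rw [Fintype.piFinset_univ] at h2
  simp_rw [Finset.mul_sum, Real.exp_sum]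
  rw [← h2]
  simp_rw [h1]
  rw [Finset.prod_mul_distrib, Finset.prod_const, Finset.prod_ite, Finset.prod_const,
    Finset.prod_const_one, mul_one, Finset.card_univ]

/-- Paley–Zygmund for `exp (θ S)` with `θ = α / √h`: the second moment is at most `exp (α²)` times
the square of the first, uniformly in `h`. -/
lemma card_signs_ge {J : Type*} [Fintype J] [DecidableEq J] (s : J → ℝ)
    (hs : ∀ j, s j = 1 ∨ s j = 0 ∨ s j = -1) {D : ℝ} (hD : 0 < D)
    (hJ : (4 * D + 4) ^ 2 ≤ #{j | s j ≠ 0}) :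
    Real.exp (-(4 * D + 4) ^ 2) / 4 * 2 ^ Fintype.card J
      ≤ #{e : J → Bool | D * √(#{j | s j ≠ 0} : ℝ) ≤ ∑ j, sign (e j) * s j} := by
  set h : ℕ := #{j | s j ≠ 0} with hh
  -- With this value `α D + 1 ≤ α² / 4`, so sign patterns outside `E` carry at most half of the
  -- first moment.
  set α := 4 * D + 4 with hα
  have hα0 : 0 < α := by positivity
  have hh0 : (0 : ℝ) < h := lt_of_lt_of_le (by positivity) hJ
  have hsq : 0 < √(h : ℝ) := Real.sqrt_pos.2 hh0
  set θ := α / √(h : ℝ) with hθ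
  have hθ0 : 0 < θ := by positivity
  have hθh : θ ^ 2 * h = α ^ 2 := by
    rw [hθ, div_pow, Real.sq_sqrt hh0.le]; field_simp
  have hθ1 : θ ^ 2 ≤ 1 := by
    rw [hθ, div_pow, Real.sq_sqrt hh0.le]; exact (div_le_one hh0).2 hJ
  set S : (J → Bool) → ℝ := fun e => ∑ j, sign (e j) * s j with hS
  set T : ℝ := 2 ^ Fintype.card J with hT
  have hT0 : 0 < T := by positivity
  have hM1 : ∑ e, Real.exp (θ * S e) = T * Real.cosh θ ^ h := sum_exp_signs s hs θ
  have hM2 : ∑ e, Real.exp (θ * S e) ^ 2 = T * Real.cosh (2 * θ) ^ h := by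
    rw [← sum_exp_signs s hs (2 * θ)]
    refine Finset.sum_congr rfl fun e _ => ?_
    rw [← Real.exp_nat_mul]
    congr 1; push_cast; ring
  have hcosh : 0 < Real.cosh θ := Real.cosh_pos θ
  set E : Finset (J → Bool) := {e | D * √(h : ℝ) ≤ S e} with hE
  have hlow : ∀ e ∉ E, Real.exp (θ * S e) ≤ Real.cosh θ ^ h / 2 := by
    intro e he
    have he' : S e < D * √(h : ℝ) := by
      by_contra hcon
      exact he (Finset.mem_filter.2 ⟨Finset.mem_univ _, not_lt.1 hcon⟩)
    have h1 : θ * S e ≤ α * D := by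
      calc θ * S e ≤ θ * (D * √(h : ℝ)) := by gcongr
        _ = α * D := by rw [hθ]; field_simp
    have h2 : Real.exp (α ^ 2 / 4) ≤ Real.cosh θ ^ h := by
      calc Real.exp (α ^ 2 / 4) = Real.exp (θ ^ 2 / 4) ^ h := by
            rw [← Real.exp_nat_mul, ← hθh]; congr 1; ring
        _ ≤ _ := by gcongr; exact exp_le_cosh hθ1
    have h3 : Real.exp (α * D) * 2 ≤ Real.exp (α ^ 2 / 4) := by
      have : (2 : ℝ) ≤ Real.exp 1 := by linarith [Real.add_one_le_exp (1 : ℝ)]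
      calc Real.exp (α * D) * 2 ≤ Real.exp (α * D) * Real.exp 1 := by gcongr
        _ = Real.exp (α * D + 1) := (Real.exp_add _ _).symm
        _ ≤ _ := by apply Real.exp_le_exp.2; nlinarith
    rw [le_div_iff₀ (by norm_num)]
    refine le_trans ?_ (h3.trans h2)
    gcongr
  have hhalf : T * Real.cosh θ ^ h / 2 ≤ ∑ e ∈ E, Real.exp (θ * S e) := by
    have h1 := Finset.sum_add_sum_compl E (fun e => Real.exp (θ * S e))
    rw [hM1] at h1
    have h2 : ∑ e ∈ Eᶜ, Real.exp (θ * S e) ≤ T * (Real.cosh θ ^ h / 2) := by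
      refine (Finset.sum_le_card_nsmul _ _ _ fun e he => hlow e (Finset.mem_compl.1 he)).trans ?_
      rw [nsmul_eq_mul]
      gcongr
      calc ((#Eᶜ : ℕ) : ℝ) ≤ (Fintype.card (J → Bool) : ℕ) := by
            exact_mod_cast Finset.card_le_univ _
        _ = T := by simp [hT]
    linarith
  have hCS : (∑ e ∈ E, Real.exp (θ * S e)) ^ 2 ≤ #E * (T * Real.cosh (2 * θ) ^ h) := by
    refine sq_sum_le_card_mul_sum_sq.trans ?_
    gcongr
    rw [← hM2]
    exact Finset.sum_le_sum_of_subset_of_nonneg (Finset.subset_univ _) fun _ _ _ => by positivity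
  have h2θ : Real.cosh (2 * θ) ^ h ≤ Real.exp (α ^ 2) * (Real.cosh θ ^ h) ^ 2 := by
    calc Real.cosh (2 * θ) ^ h ≤ (Real.exp (θ ^ 2) * Real.cosh θ ^ 2) ^ h := by
          have := Real.cosh_pos (2 * θ)
          gcongr; exact cosh_two_mul_le θ
      _ = _ := by
          rw [mul_pow, ← Real.exp_nat_mul, ← hθh]
          ring_nf
  set c := Real.cosh θ ^ h with hc
  have hc0 : 0 < c := by positivity
  have h5 : (T * c / 2) ^ 2 ≤ #E * (T * (Real.exp (α ^ 2) * c ^ 2)) := by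
    refine (pow_le_pow_left₀ (by positivity) hhalf 2).trans (hCS.trans ?_)
    gcongr
  have h6 : T / 4 ≤ #E * Real.exp (α ^ 2) := by
    have : 0 < T * c ^ 2 := by positivity
    refine le_of_mul_le_mul_left ?_ this
    calc T * c ^ 2 * (T / 4) = (T * c / 2) ^ 2 := by ring
      _ ≤ _ := h5
      _ = _ := by ring
  rw [Real.exp_neg, div_mul_eq_mul_div, inv_mul_eq_div, div_div, mul_comm (Real.exp _) 4, ← div_div,
    div_le_iff₀ (Real.exp_pos _)]
  exact h6

/-! ### Local exchanges of parts -/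

/-- A family of disjoint quadruples of part sizes `x₀, x₁, x₂, x₃` with `x₀ + x₃ = x₁ + x₂`,
each with a step width: exchanging `step` copies of `x₀, x₃` for `step` copies of `x₁, x₂`
preserves the sum of a partition. -/
structure QuadSystem (n : ℕ) (ι : Type*) where
  site : ι → Fin 4 → ℕ
  step : ι → ℕ
  step_pos : ∀ a, 0 < step a
  site_mem : ∀ a c, site a c ∈ Icc 1 n
  site_inj : ∀ a c a' c', site a c = site a' c' → a = a' ∧ c = c'
  balance : ∀ a, site a 0 + site a 3 = site a 1 + site a 2

namespace QuadSystem

variable {n : ℕ} {ι : Type*} (q : QuadSystem n ι)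

/-- The orientation of the four members of a quadruple. -/
def orient : Fin 4 → ℤ := ![1, -1, -1, 1]

/-- The direction in which the exchange at `a` acts on the multiplicities `m`, or zero if it
does not act. -/
def dir (a : ι) (m : ℕ → ℕ) : ℤ :=
  if (m (q.site a 0) / q.step a) % 2 = 0 then
    if q.step a ≤ m (q.site a 1) ∧ q.step a ≤ m (q.site a 2) then 1 else 0
  else if q.step a ≤ m (q.site a 3) then -1 else 0

/-- The signed number of copies exchanged at `a` under the choice `e`. -/
def shift (e : ι → Bool) (m : ℕ → ℕ) (a : ι) : ℤ := if e a then q.dir a m * q.step a else 0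

lemma shift_nonneg_site (e : ι → Bool) (m : ℕ → ℕ) (a : ι) (c : Fin 4) :
    0 ≤ (m (q.site a c) : ℤ) + q.shift e m a * orient c := by
  unfold shift dir
  have hb := q.step_pos a
  -- An odd quotient is nonzero, so the reverse exchange never lacks copies at site 0.
  have h0 : (m (q.site a 0) / q.step a) % 2 ≠ 0 → q.step a ≤ m (q.site a 0) := by
    intro h
    by_contra hcon
    rw [Nat.div_eq_of_lt (not_le.1 hcon)] at h
    exact h rfl
  split_ifs with h1 h2 h3 h4 <;> fin_cases c <;> simp [orient] <;> try omega

variable [Fintype ι]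

/-- The total effect of the exchanges `e` at the part size `s`. -/
def delta (e : ι → Bool) (m : ℕ → ℕ) (s : ℕ) : ℤ :=
  ∑ a, q.shift e m a * ∑ c, orient c * (if q.site a c = s then 1 else 0)

lemma delta_site (e : ι → Bool) (m : ℕ → ℕ) (a : ι) (c : Fin 4) :
    q.delta e m (q.site a c) = q.shift e m a * orient c := by
  classical
  rw [delta, Finset.sum_eq_single a]
  · congr 1
    rw [Finset.sum_eq_single c]
    · simp
    · intro c' _ hc'
      rw [if_neg fun h => hc' (q.site_inj _ _ _ _ h).2, mul_zero]
    · simp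
  · intro a' _ ha'
    rw [Finset.sum_eq_zero, mul_zero]
    intro c' _
    rw [if_neg fun h => ha' (q.site_inj _ _ _ _ h).1, mul_zero]
  · simp

lemma delta_of_ne (e : ι → Bool) (m : ℕ → ℕ) {s : ℕ} (h : ∀ a c, q.site a c ≠ s) :
    q.delta e m s = 0 :=
  Finset.sum_eq_zero fun a _ => by
    rw [Finset.sum_eq_zero, mul_zero]
    intro c _
    rw [if_neg (h a c), mul_zero]

lemma nonneg (e : ι → Bool) (m : ℕ → ℕ) (s : ℕ) : 0 ≤ (m s : ℤ) + q.delta e m s := by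
  by_cases h : ∃ a c, q.site a c = s
  · obtain ⟨a, c, rfl⟩ := h
    rw [delta_site]
    exact q.shift_nonneg_site e m a c
  · push Not at h
    rw [q.delta_of_ne e m h]
    omega

/-- The multiplicities after the exchanges `e`. -/
def flipMult (e : ι → Bool) (m : ℕ → ℕ) (s : ℕ) : ℕ := ((m s : ℤ) + q.delta e m s).toNat

lemma flipMult_cast (e : ι → Bool) (m : ℕ → ℕ) (s : ℕ) :
    (q.flipMult e m s : ℤ) = m s + q.delta e m s := Int.toNat_of_nonneg (q.nonneg e m s)

lemma flipMult_site (e : ι → Bool) (m : ℕ → ℕ) (a : ι) (c : Fin 4) :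
    (q.flipMult e m (q.site a c) : ℤ) = m (q.site a c) + q.shift e m a * orient c := by
  rw [flipMult_cast, delta_site]

/-- An active exchange changes the quotient at site 0 by one, hence its parity, and leaves enough
copies for the way back. The direction is thus reversed, and repeating an exchange undoes it. -/
lemma dir_flipMult (e : ι → Bool) (m : ℕ → ℕ) (a : ι) :
    q.dir a (q.flipMult e m) = if e a then -q.dir a m else q.dir a m := by
  have hb := q.step_pos a
  have f0 := q.flipMult_site e m a 0
  have f1 := q.flipMult_site e m a 1
  have f2 := q.flipMult_site e m a 2
  have f3 := q.flipMult_site e m a 3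
  simp only [orient, Matrix.cons_val] at f0 f1 f2 f3
  unfold shift at f0 f1 f2 f3
  unfold dir at f0 f1 f2 f3 ⊢
  set b := q.step a
  generalize m (q.site a 0) = y0 at *
  generalize m (q.site a 1) = y1 at *
  generalize m (q.site a 2) = y2 at *
  generalize m (q.site a 3) = y3 at *
  generalize q.flipMult e m (q.site a 0) = z0 at *
  generalize q.flipMult e m (q.site a 1) = z1 at *
  generalize q.flipMult e m (q.site a 2) = z2 at *
  generalize q.flipMult e m (q.site a 3) = z3 at *
  by_cases he : e a
  · rw [if_pos he] at f0 f1 f2 f3 ⊢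
    by_cases h0 : y0 / b % 2 = 0
    · by_cases h1 : b ≤ y1 ∧ b ≤ y2
      · rw [if_pos h0, if_pos h1] at f0 f1 f2 f3 ⊢
        have e0 : z0 = y0 + b := by omega
        have e3 : b ≤ z3 := by omega
        have : ¬ z0 / b % 2 = 0 := by
          rw [e0, Nat.add_div_right _ hb]; omega
        rw [if_neg this, if_pos e3]
      · rw [if_pos h0, if_neg h1] at f0 f1 f2 f3 ⊢
        have e0 : z0 = y0 := by omega
        have e1 : z1 = y1 := by omega
        have e2 : z2 = y2 := by omega
        rw [e0, e1, e2, if_pos h0, if_neg h1]; simp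
    · by_cases h3 : b ≤ y3
      · rw [if_neg h0, if_pos h3] at f0 f1 f2 f3 ⊢
        have hy0 : b ≤ y0 := by
          by_contra hcon
          rw [Nat.div_eq_of_lt (not_le.1 hcon)] at h0
          exact h0 rfl
        have e0 : y0 = z0 + b := by omega
        have e1 : b ≤ z1 := by omega
        have e2 : b ≤ z2 := by omega
        have : z0 / b % 2 = 0 := by
          rw [e0, Nat.add_div_right _ hb] at h0; omega
        rw [if_pos this, if_pos ⟨e1, e2⟩]; simp
      · rw [if_neg h0, if_neg h3] at f0 f1 f2 f3 ⊢
        have e0 : z0 = y0 := by omega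
        have e3 : z3 = y3 := by omega
        rw [e0, e3, if_neg h0, if_neg h3]; simp
  · rw [if_neg he] at f0 f1 f2 f3 ⊢
    have e0 : z0 = y0 := by omega
    have e1 : z1 = y1 := by omega
    have e2 : z2 = y2 := by omega
    have e3 : z3 = y3 := by omega
    rw [e0, e1, e2, e3]

lemma shift_flipMult (e : ι → Bool) (m : ℕ → ℕ) (a : ι) :
    q.shift e (q.flipMult e m) a = -q.shift e m a := by
  rw [shift, shift, dir_flipMult]
  split_ifs <;> simp

lemma flipMult_flipMult (e : ι → Bool) (m : ℕ → ℕ) : q.flipMult e (q.flipMult e m) = m := by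
  funext s
  have h : q.delta e (q.flipMult e m) s = -q.delta e m s := by
    simp only [delta, shift_flipMult, neg_mul, Finset.sum_neg_distrib]
  have := q.flipMult_cast e (q.flipMult e m) s
  have h2 := q.flipMult_cast e m s
  rw [h] at this
  omega

lemma sum_mul_flipMult (e : ι → Bool) (m : ℕ → ℕ) (φ : ℕ → ℤ) :
    ∑ s ∈ Icc 1 n, φ s * (q.flipMult e m s : ℤ) = ∑ s ∈ Icc 1 n, φ s * (m s : ℤ)
      + ∑ a, q.shift e m a * ∑ c, orient c * φ (q.site a c) := by
  simp_rw [flipMult_cast, mul_add, Finset.sum_add_distrib]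
  congr 1
  simp_rw [delta, Finset.mul_sum]
  rw [Finset.sum_comm]
  refine Finset.sum_congr rfl fun a _ => ?_
  rw [Finset.sum_comm]
  refine Finset.sum_congr rfl fun c _ => ?_
  rw [Finset.sum_eq_single (q.site a c)]
  · simp; ring
  · intro s _ hs
    rw [if_neg (Ne.symm hs)]; simp
  · intro h
    exact absurd (q.site_mem a c) h

lemma sum_flipMult (e : ι → Bool) (lam : n.Partition) :
    ∑ s ∈ Icc 1 n, s * q.flipMult e (mult lam) s = n := by
  have h := q.sum_mul_flipMult e (mult lam) (fun s => (s : ℤ))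
  have h1 : ∀ a, ∑ c, orient c * (q.site a c : ℤ) = 0 := by
    intro a
    have := q.balance a
    simp only [Fin.sum_univ_four, orient, Matrix.cons_val]
    omega
  simp only [h1, mul_zero, Finset.sum_const_zero, add_zero] at h
  have h2 : ∑ s ∈ Icc 1 n, (s : ℤ) * (mult lam s : ℤ) = n := by exact_mod_cast sum_mul_mult lam
  rw [h2] at h
  exact_mod_cast h

/-- The partition after the exchanges `e`. -/
def flip (e : ι → Bool) (lam : n.Partition) : n.Partition :=
  ofMult n (q.flipMult e (mult lam)) (q.sum_flipMult e lam)

lemma mult_flip (e : ι → Bool) (lam : n.Partition) :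
    mult (q.flip e lam) = q.flipMult e (mult lam) := by
  funext s
  by_cases hs : s ∈ Icc 1 n
  · exact mult_ofMult _ hs
  · rw [mult_eq_zero _ hs, flipMult, mult_eq_zero _ hs, q.delta_of_ne]
    · rfl
    · rintro a c rfl
      exact hs (q.site_mem a c)

lemma flip_involutive (e : ι → Bool) : Function.Involutive (q.flip e) := by
  intro lam
  apply mult_injective
  rw [mult_flip, mult_flip, flipMult_flipMult]

/-- The effect of one exchange at `a` on the part sum truncated at `t`. -/
def slope (t : ℕ) (a : ι) : ℤ := ∑ c, orient c * (min (q.site a c) t : ℕ)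

lemma capSum_flip (e : ι → Bool) (lam : n.Partition) (t : ℕ) :
    (capSum (q.flip e lam) t : ℤ)
      = capSum lam t + ∑ a, q.shift e (mult lam) a * q.slope t a := by
  have h := q.sum_mul_flipMult e (mult lam) (fun s => ((min s t : ℕ) : ℤ))
  simp only [capSum, mult_flip, slope]
  push_cast at h ⊢
  exact h

/-- The mean discrepancy over all exchanges. -/
noncomputable def center (lam mu : n.Partition) (t : ℕ) : ℝ :=
  disc lam mu t + ∑ a, (q.dir a (mult lam) * q.step a * q.slope t a : ℝ) / 2

lemma disc_flip (e : ι → Bool) (lam mu : n.Partition) (t : ℕ) :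
    disc (q.flip e lam) mu t = q.center lam mu t
      + ∑ a, sign (e a) * ((q.dir a (mult lam) * q.step a * q.slope t a : ℝ) / 2) := by
  have h : (capSum (q.flip e lam) t : ℝ)
      = capSum lam t + ∑ a, (q.shift e (mult lam) a : ℝ) * q.slope t a := by
    exact_mod_cast congrArg (Int.cast : ℤ → ℝ) (q.capSum_flip e lam t)
  rw [disc, h, center, disc, add_assoc, ← Finset.sum_add_distrib, add_sub_right_comm]
  congr 1
  refine Finset.sum_congr rfl fun a _ => ?_
  unfold shift sign
  split_ifs <;> push_cast <;> ring

end QuadSystem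

/-! ### Averaging over exchanges -/

namespace QuadSystem

variable {n : ℕ} {ι : Type*} [Fintype ι] [DecidableEq ι] (q : QuadSystem n ι)

omit [DecidableEq ι] [Fintype ι] in
lemma dir_eq (a : ι) (m : ℕ → ℕ) : q.dir a m = 1 ∨ q.dir a m = 0 ∨ q.dir a m = -1 := by
  unfold dir
  split_ifs <;> simp

lemma sum_sign (a : ι) : ∑ e : ι → Bool, sign (e a) = 0 := by
  have h : ∑ e : ι → Bool, sign (e a) = ∑ e : ι → Bool, -sign (e a) := by
    refine Fintype.sum_equiv (Equiv.arrowCongr (Equiv.refl ι) Equiv.boolNot) _ _ fun e => ?_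
    cases h : e a <;> simp [sign, h]
  rw [Finset.sum_neg_distrib] at h
  linarith

lemma sum_disc_flip (lam mu : n.Partition) (t : ℕ) :
    ∑ e : ι → Bool, disc (q.flip e lam) mu t
      = Fintype.card (ι → Bool) * q.center lam mu t := by
  simp_rw [disc_flip, Finset.sum_add_distrib]
  rw [Finset.sum_comm]
  simp_rw [← Finset.sum_mul, sum_sign]
  simp

/-- Averaging over exchanges does not increase exponential moments. -/
lemma sum_exp_center_le {κ : Type*} [Fintype κ] (θ : κ → ℝ) (t : κ → ℕ) :
    ∑ lam : n.Partition, ∑ mu : n.Partition, Real.exp (∑ k, |θ k * q.center lam mu (t k)|)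
      ≤ ∑ lam : n.Partition, ∑ mu : n.Partition, Real.exp (∑ k, |θ k * disc lam mu (t k)|) := by
  set M : ℝ := ((Fintype.card (ι → Bool) : ℕ) : ℝ) with hM
  have hM0 : 0 < M := by rw [hM]; exact_mod_cast Fintype.card_pos
  have hpt : ∀ lam mu : n.Partition, M * Real.exp (∑ k, |θ k * q.center lam mu (t k)|)
      ≤ ∑ e : ι → Bool, Real.exp (∑ k, |θ k * disc (q.flip e lam) mu (t k)|) := by
    intro lam mu
    set y := ∑ k, |θ k * q.center lam mu (t k)| with hy
    set x : (ι → Bool) → ℝ := fun e => ∑ k, |θ k * disc (q.flip e lam) mu (t k)| with hx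
    -- The center is the orbit mean of the discrepancy, so this is the triangle inequality; the
    -- tangent line of `exp` at `y` then gives Jensen.
    have h1 : M * y ≤ ∑ e, x e := by
      rw [hy, Finset.mul_sum, hx, Finset.sum_comm]
      refine Finset.sum_le_sum fun k _ => ?_
      calc M * |θ k * q.center lam mu (t k)| = |∑ e, θ k * disc (q.flip e lam) mu (t k)| := by
            rw [← Finset.mul_sum, sum_disc_flip, abs_mul, abs_mul, abs_mul, ← hM,
              abs_of_pos hM0]
            ring
        _ ≤ _ := Finset.abs_sum_le_sum_abs _ _
    have h2 : ∀ e, Real.exp y * (1 + (x e - y)) ≤ Real.exp (x e) := by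
      intro e
      have := Real.add_one_le_exp (x e - y)
      calc Real.exp y * (1 + (x e - y)) ≤ Real.exp y * Real.exp (x e - y) := by
            gcongr; linarith
        _ = _ := by rw [← Real.exp_add]; congr 1; ring
    refine le_trans ?_ (Finset.sum_le_sum fun e _ => h2 e)
    rw [← Finset.mul_sum, Finset.sum_add_distrib, Finset.sum_sub_distrib]
    simp only [Finset.sum_const, Finset.card_univ, nsmul_eq_mul, mul_one, ← hM]
    nlinarith [Real.exp_pos y]
  have h3 : M * ∑ lam : n.Partition, ∑ mu : n.Partition,
        Real.exp (∑ k, |θ k * q.center lam mu (t k)|)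
      ≤ M * ∑ lam : n.Partition, ∑ mu : n.Partition, Real.exp (∑ k, |θ k * disc lam mu (t k)|) := by
    calc _ ≤ ∑ lam : n.Partition, ∑ mu : n.Partition, ∑ e : ι → Bool,
          Real.exp (∑ k, |θ k * disc (q.flip e lam) mu (t k)|) := by
          simp_rw [Finset.mul_sum]
          exact Finset.sum_le_sum fun lam _ => Finset.sum_le_sum fun mu _ => hpt lam mu
      _ = ∑ e : ι → Bool, ∑ lam : n.Partition, ∑ mu : n.Partition,
          Real.exp (∑ k, |θ k * disc (q.flip e lam) mu (t k)|) := by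
          rw [Finset.sum_comm (s := (univ : Finset (ι → Bool)))]
          exact Finset.sum_congr rfl fun lam _ => Finset.sum_comm
      _ = ∑ e : ι → Bool, ∑ lam : n.Partition, ∑ mu : n.Partition,
          Real.exp (∑ k, |θ k * disc lam mu (t k)|) := by
          refine Finset.sum_congr rfl fun e _ => ?_
          exact Equiv.sum_comp (q.flip_involutive e).toPerm
            (fun lam => ∑ mu : n.Partition, Real.exp (∑ k, |θ k * disc lam mu (t k)|))
      _ = _ := by rw [Finset.sum_const, Finset.card_univ, nsmul_eq_mul]
  exact le_of_mul_le_mul_left h3 hM0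

open Classical in
/-- The number of comparable pairs, averaged over exchanges. -/
lemma card_dominatedBy_mul :
    #{p : n.Partition × n.Partition | DominatedBy p.2 p.1} * Fintype.card (ι → Bool)
      = ∑ p : n.Partition × n.Partition, #{e : ι → Bool | DominatedBy p.2 (q.flip e p.1)} := by
  simp_rw [Finset.card_filter]
  rw [Finset.sum_comm]
  have h : ∀ e : ι → Bool, ∑ p : n.Partition × n.Partition,
      (if DominatedBy p.2 (q.flip e p.1) then 1 else 0)
        = ∑ p : n.Partition × n.Partition, (if DominatedBy p.2 p.1 then 1 else 0) := fun e =>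
    Equiv.sum_comp (Equiv.prodCongr (q.flip_involutive e).toPerm (Equiv.refl _))
      (fun p : n.Partition × n.Partition => if DominatedBy p.2 p.1 then 1 else 0)
  rw [Finset.sum_congr rfl fun e _ => h e, Finset.sum_const, Finset.card_univ, smul_eq_mul,
    mul_comm]

end QuadSystem

/-! ### Exchanges at geometric scales -/

lemma two_dvd_sixteen_pow {i : ℕ} (hi : 0 < i) (k : ℕ) : 2 * (16 ^ (i + k) / 2) = 16 ^ (i + k) := by
  refine Nat.mul_div_cancel' (Dvd.dvd.trans (by norm_num) (dvd_pow_self 16 (by omega)))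

/-- The index set of the exchanges at scales `16 ^ i, …, 16 ^ (i + K - 1)`. -/
abbrev ScaleIndex (i K : ℕ) : Type := Σ k : Fin K, Fin (16 ^ (i + (k : ℕ)) / 2)

lemma sixteen_pow_mul_le {k l : ℕ} (h : k < l) (i : ℕ) : 16 * 16 ^ (i + k) ≤ 16 ^ (i + l) := by
  rw [← pow_succ']
  exact Nat.pow_le_pow_right (by norm_num) (by omega)

/-- The part sizes exchanged at the scales `16 ^ i, …, 16 ^ (i + K - 1)`. -/
def scaleSite (i K : ℕ) (a : ScaleIndex i K) (c : Fin 4) : ℕ :=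
  c * 16 ^ (i + (a.1 : ℕ)) + (16 ^ (i + (a.1 : ℕ)) / 2 + 1 + a.2)

/-- Member `c` lies in the upper half of `(c r, (c + 1) r]`, so all members at scale `r` lie in
`(r/2, 4r]`. Consecutive scales differ by a factor 16, which keeps these ranges disjoint. -/
lemma scaleSite_bounds {i K : ℕ} (hi : 0 < i) (a : ScaleIndex i K) (c : Fin 4) :
    c * 16 ^ (i + (a.1 : ℕ)) < scaleSite i K a c ∧
      scaleSite i K a c ≤ (c + 1) * 16 ^ (i + (a.1 : ℕ)) ∧
      16 ^ (i + (a.1 : ℕ)) < 2 * scaleSite i K a c ∧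
      scaleSite i K a c ≤ 4 * 16 ^ (i + (a.1 : ℕ)) := by
  have h1 := two_dvd_sixteen_pow hi a.1
  have h2 := a.2.2
  have h3 : (c : ℕ) * 16 ^ (i + (a.1 : ℕ)) ≤ 3 * 16 ^ (i + (a.1 : ℕ)) :=
    Nat.mul_le_mul_right _ (by omega)
  unfold scaleSite
  rw [add_mul]
  omega

lemma scaleSite_inj {i K : ℕ} (hi : 0 < i) (a : ScaleIndex i K) (c : Fin 4) (a' : ScaleIndex i K)
    (c' : Fin 4) (h : scaleSite i K a c = scaleSite i K a' c') : a = a' ∧ c = c' := by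
  obtain ⟨p1, p2, p3, p4⟩ := scaleSite_bounds hi a c
  obtain ⟨p1', p2', p3', p4'⟩ := scaleSite_bounds hi a' c'
  rw [← h] at p1' p2' p3' p4'
  obtain ⟨k, j⟩ := a
  obtain ⟨k', j'⟩ := a'
  dsimp only at *
  have hk : k = k' := by
    rcases lt_trichotomy (k : ℕ) k' with hlt | heq | hlt
    · have := sixteen_pow_mul_le hlt i
      omega
    · exact Fin.ext heq
    · have := sixteen_pow_mul_le hlt i
      omega
  subst hk
  have hc : c = c' := by
    have hr : 0 < 16 ^ (i + (k : ℕ)) := by positivity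
    rcases lt_trichotomy (c : ℕ) c' with hlt | heq | hlt
    · have := Nat.mul_le_mul_right (16 ^ (i + (k : ℕ))) (Nat.succ_le_of_lt hlt)
      rw [Nat.succ_eq_add_one] at this
      omega
    · exact Fin.ext heq
    · have := Nat.mul_le_mul_right (16 ^ (i + (k : ℕ))) (Nat.succ_le_of_lt hlt)
      rw [Nat.succ_eq_add_one] at this
      omega
  subst hc
  refine ⟨?_, rfl⟩
  unfold scaleSite at h
  dsimp only at h
  have : j = j' := Fin.ext (by omega)
  rw [this]

/-- The exchanges at the scales `16 ^ i, …, 16 ^ (i + K - 1)`. -/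
def scaleSystem (n i K : ℕ) (hi : 0 < i) (hn : ∀ k < K, 4 * 16 ^ (i + k) ≤ n) (b : Fin K → ℕ)
    (hb : ∀ k, 0 < b k) : QuadSystem n (ScaleIndex i K) where
  site := scaleSite i K
  step a := b a.1
  step_pos a := hb a.1
  site_mem a c := by
    obtain ⟨-, -, h3, h4⟩ := scaleSite_bounds hi a c
    have := hn a.1 a.1.2
    exact Finset.mem_Icc.2 ⟨by omega, by omega⟩
  site_inj := scaleSite_inj hi
  balance a := by
    simp [scaleSite]
    ring

section Scale

variable {n i K : ℕ} {hi : 0 < i} {hn : ∀ k < K, 4 * 16 ^ (i + k) ≤ n} {b : Fin K → ℕ}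
  {hb : ∀ k, 0 < b k}

/-- At its own level `2r`, members 2 and 3 are both cut to `2r` and cancel, leaving `x₀ - x₁ = -r`.
A higher level cuts nothing, and the balance gives zero; a lower one cuts all four to the same
value. -/
lemma slope_scaleSystem (k : Fin K) (a : ScaleIndex i K) :
    (scaleSystem n i K hi hn b hb).slope (2 * 16 ^ (i + (k : ℕ))) a
      = if a.1 = k then -((16 ^ (i + (k : ℕ)) : ℕ) : ℤ) else 0 := by
  obtain ⟨l, j⟩ := a
  have h0 := scaleSite_bounds hi ⟨l, j⟩ 0
  have h1 := scaleSite_bounds hi ⟨l, j⟩ 1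
  have h2 := scaleSite_bounds hi ⟨l, j⟩ 2
  have h3 := scaleSite_bounds hi ⟨l, j⟩ 3
  have hbal := (scaleSystem n i K hi hn b hb).balance ⟨l, j⟩
  have h10 : scaleSite i K ⟨l, j⟩ 1 = 16 ^ (i + (l : ℕ)) + scaleSite i K ⟨l, j⟩ 0 := by
    simp [scaleSite]
  simp only [QuadSystem.slope, Fin.sum_univ_four, QuadSystem.orient, Matrix.cons_val, scaleSystem,
    Fin.isValue, Fin.coe_ofNat_eq_mod] at *
  rcases lt_trichotomy (l : ℕ) k with hlt | heq | hlt
  · have := sixteen_pow_mul_le hlt i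
    rw [if_neg (by rintro rfl; omega)]
    omega
  · have hlk : l = k := Fin.ext heq
    subst hlk
    rw [if_pos rfl]
    omega
  · have := sixteen_pow_mul_le hlt i
    rw [if_neg (by rintro rfl; omega)]
    omega

/-- An inert quadruple has a member among 1, 2, 3, hence in `(r, 4r]`, with multiplicity below `b
k`. Choosing one injects inert quadruples into short sites, so at most `r/4` of the `r/2` quadruples
are inert. -/
lemma card_dir_ne_zero (lam : n.Partition) (k : Fin K)
    (h : 4 * #{s ∈ Ioc (16 ^ (i + (k : ℕ))) (4 * 16 ^ (i + (k : ℕ))) | mult lam s < b k}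
      ≤ 16 ^ (i + (k : ℕ))) :
    16 ^ (i + (k : ℕ)) ≤ 4 * #{j : Fin (16 ^ (i + (k : ℕ)) / 2) |
      (scaleSystem n i K hi hn b hb).dir ⟨k, j⟩ (mult lam) ≠ 0} := by
  set q := scaleSystem n i K hi hn b hb
  set r := 16 ^ (i + (k : ℕ)) with hr
  have h1 : #{j : Fin (r / 2) | q.dir ⟨k, j⟩ (mult lam) ≠ 0}
      + #{j : Fin (r / 2) | ¬ q.dir ⟨k, j⟩ (mult lam) ≠ 0} = r / 2 := by
    rw [Finset.card_filter_add_card_filter_not, Finset.card_univ, Fintype.card_fin]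
  have h2 : #{j : Fin (r / 2) | ¬ q.dir ⟨k, j⟩ (mult lam) ≠ 0}
      ≤ #{s ∈ Ioc r (4 * r) | mult lam s < b k} := by
    let g : Fin (r / 2) → Fin 4 := fun j =>
      if mult lam (q.site ⟨k, j⟩ 1) < b k then 1 else
        if mult lam (q.site ⟨k, j⟩ 2) < b k then 2 else 3
    refine Finset.card_le_card_of_injOn (fun j => q.site ⟨k, j⟩ (g j)) ?_ ?_
    · intro j hj
      have hj' := (Finset.mem_filter.1 hj).2
      rw [not_not] at hj'
      have hg : 1 ≤ (g j : ℕ) := by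
        simp only [g]; split_ifs <;> simp
      refine Finset.mem_coe.2 (Finset.mem_filter.2 ⟨?_, ?_⟩)
      · obtain ⟨p1, p2, p3, p4⟩ := scaleSite_bounds hi ⟨k, j⟩ (g j)
        refine Finset.mem_Ioc.2 ⟨lt_of_le_of_lt ?_ p1, p4⟩
        exact Nat.le_mul_of_pos_left _ hg
      · simp only [g]
        split_ifs with c1 c2
        · exact c1
        · exact c2
        · by_contra hcon
          unfold QuadSystem.dir at hj'
          have hstep : q.step ⟨k, j⟩ = b k := rfl
          rw [hstep, if_pos (And.intro (not_lt.1 c1) (not_lt.1 c2)), if_pos (not_lt.1 hcon)] at hj'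
          split_ifs at hj'
          all_goals simp at hj'
    · intro j _ j' _ hjj
      have := (q.site_inj _ _ _ _ hjj).1
      simpa using this
  have h3 : 2 * (r / 2) = r := two_dvd_sixteen_pow hi k
  have h4 : r ≤ 4 * #{j : Fin (r / 2) | q.dir ⟨k, j⟩ (mult lam) ≠ 0} := by omega
  convert h4

lemma disc_flip_scaleSystem (e : ScaleIndex i K → Bool) (lam mu : n.Partition) (k : Fin K) :
    disc ((scaleSystem n i K hi hn b hb).flip e lam) mu (2 * 16 ^ (i + (k : ℕ)))
      = (scaleSystem n i K hi hn b hb).center lam mu (2 * 16 ^ (i + (k : ℕ)))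
        - (16 ^ (i + (k : ℕ)) * b k / 2 : ℝ) * ∑ j, sign (e ⟨k, j⟩) *
          ((scaleSystem n i K hi hn b hb).dir ⟨k, j⟩ (mult lam) : ℝ) := by
  rw [QuadSystem.disc_flip, sub_eq_add_neg]
  congr 1
  rw [Fintype.sum_sigma, Finset.sum_eq_single k]
  · rw [Finset.mul_sum, ← Finset.sum_neg_distrib]
    refine Finset.sum_congr rfl fun j _ => ?_
    rw [slope_scaleSystem, if_pos rfl]
    simp only [scaleSystem]
    push_cast
    ring
  · intro l _ hl
    refine Finset.sum_eq_zero fun j _ => ?_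
    rw [slope_scaleSystem, if_neg hl]
    simp
  · simp

end Scale

/-! ### Comparable pairs within an orbit of exchanges -/

lemma card_signs_sub_le {J : Type*} [Fintype J] [DecidableEq J] (s : J → ℝ)
    (hs : ∀ j, s j = 1 ∨ s j = 0 ∨ s j = -1) {D A w : ℝ} (hD : 0 < D) (hw : 0 < w)
    (hJ : (4 * D + 4) ^ 2 ≤ #{j | s j ≠ 0}) (hA : -(w * (D * √(#{j | s j ≠ 0} : ℝ))) < A) :
    (#{f : J → Bool | A - w * ∑ j, sign (f j) * s j ≤ 0} : ℝ)
      ≤ (1 - Real.exp (-(4 * D + 4) ^ 2) / 4) * 2 ^ Fintype.card J := by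
  have hset : #{j | -s j ≠ 0} = #{j | s j ≠ 0} := by
    congr 1; ext j; simp
  have h := card_signs_ge (fun j => -s j) (fun j => by rcases hs j with h | h | h <;> simp [h]) hD
    (by rwa [hset])
  rw [hset] at h
  set E : Finset (J → Bool) := {f | D * √(#{j | s j ≠ 0} : ℝ) ≤ ∑ j, sign (f j) * -s j} with hE
  set F : Finset (J → Bool) := {f | A - w * ∑ j, sign (f j) * s j ≤ 0} with hF
  have hdis : Disjoint F E := by
    rw [Finset.disjoint_left]
    intro f hf he
    have h1 := (Finset.mem_filter.1 hf).2
    have h2 := (Finset.mem_filter.1 he).2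
    simp only [mul_neg, Finset.sum_neg_distrib] at h2
    have := mul_le_mul_of_nonneg_left h2 hw.le
    linarith
  have h3 : #F + #E ≤ 2 ^ Fintype.card J := by
    rw [← Finset.card_union_of_disjoint hdis]
    exact (Finset.card_le_univ _).trans (by simp)
  have h4 : (#F : ℝ) + #E ≤ 2 ^ Fintype.card J := by exact_mod_cast h3
  linarith

lemma card_filter_sigma {κ : Type*} [Fintype κ] [DecidableEq κ] {J : κ → Type*}
    [∀ k, Fintype (J k)] [∀ k, DecidableEq (J k)] (P : ∀ k, (J k → Bool) → Prop)
    [∀ k, DecidablePred (P k)] :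
    #{e : (Σ k, J k) → Bool | ∀ k, P k (fun j => e ⟨k, j⟩)} = ∏ k, #{f : J k → Bool | P k f} := by
  rw [← Fintype.card_piFinset]
  refine Finset.card_equiv (Equiv.piCurry fun k (_ : J k) => Bool) fun e => ?_
  simp only [Finset.mem_filter, Finset.mem_univ, true_and, Fintype.mem_piFinset]
  rfl

-- Dominance forces a nonpositive discrepancy at each level. These conditions involve disjoint
-- blocks of signs, so the count is bounded by a product; at the levels in `T` the center is within
-- `D` standard deviations of zero and the factor `1 - δ` is gained.
open Classical in
lemma card_dominatedBy_flip_le {n i K : ℕ} {hi : 0 < i} {hn : ∀ k < K, 4 * 16 ^ (i + k) ≤ n}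
    {b : Fin K → ℕ} {hb : ∀ k, 0 < b k} (lam mu : n.Partition) {D : ℝ} (hD : 0 < D)
    (T : Finset (Fin K))
    (hT : ∀ k ∈ T, (4 * D + 4) ^ 2 ≤ ((16 : ℝ) ^ (i + (k : ℕ))) / 4 ∧
      4 * #{s ∈ Ioc (16 ^ (i + (k : ℕ))) (4 * 16 ^ (i + (k : ℕ))) | mult lam s < b k}
        ≤ 16 ^ (i + (k : ℕ)) ∧
      |(scaleSystem n i K hi hn b hb).center lam mu (2 * 16 ^ (i + (k : ℕ)))|
        < 16 ^ (i + (k : ℕ)) * b k / 4 * (D * 4 ^ (i + (k : ℕ)))) :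
    (#{e : ScaleIndex i K → Bool |
        DominatedBy mu ((scaleSystem n i K hi hn b hb).flip e lam)} : ℝ)
      ≤ (1 - Real.exp (-(4 * D + 4) ^ 2) / 4) ^ #T * Fintype.card (ScaleIndex i K → Bool) := by
  set q := scaleSystem n i K hi hn b hb
  set δ := Real.exp (-(4 * D + 4) ^ 2) / 4 with hδ
  have hδ1 : 0 ≤ 1 - δ := by
    have : Real.exp (-(4 * D + 4) ^ 2) ≤ 1 := by
      rw [← Real.exp_zero]
      exact Real.exp_le_exp.2 (by nlinarith [sq_nonneg (4 * D + 4)])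
    rw [hδ]; linarith
  set P : ∀ k : Fin K, (Fin (16 ^ (i + (k : ℕ)) / 2) → Bool) → Prop := fun k f =>
    q.center lam mu (2 * 16 ^ (i + (k : ℕ))) - (16 ^ (i + (k : ℕ)) * b k / 2 : ℝ) *
      ∑ j, sign (f j) * (q.dir ⟨k, j⟩ (mult lam) : ℝ) ≤ 0 with hP
  have h1 : #{e : ScaleIndex i K → Bool | DominatedBy mu (q.flip e lam)}
      ≤ #{e : ScaleIndex i K → Bool | ∀ k, P k (fun j => e ⟨k, j⟩)} := by
    refine Finset.card_le_card fun e he => Finset.mem_filter.2 ⟨Finset.mem_univ _, fun k => ?_⟩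
    have h2 := (Finset.mem_filter.1 he).2.capSum_le (2 * 16 ^ (i + (k : ℕ)))
    have h3 : (capSum (q.flip e lam) (2 * 16 ^ (i + (k : ℕ))) : ℝ)
        ≤ capSum mu (2 * 16 ^ (i + (k : ℕ))) := by exact_mod_cast h2
    simp only [hP]
    rw [← disc_flip_scaleSystem e lam mu k, disc]
    linarith
  replace h1 : #{e : ScaleIndex i K → Bool | DominatedBy mu (q.flip e lam)}
      ≤ ∏ k, #{f | P k f} := h1.trans (le_of_eq (by convert card_filter_sigma P))
  have h2 : ∀ k : Fin K, (#{f | P k f} : ℝ)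
      ≤ (if k ∈ T then 1 - δ else 1) * 2 ^ (16 ^ (i + (k : ℕ)) / 2) := by
    intro k
    split_ifs with hk
    · obtain ⟨t1, t2, t3⟩ := hT k hk
      have h3 := card_dir_ne_zero (hi := hi) (hn := hn) (hb := hb) lam k t2
      set s : Fin (16 ^ (i + (k : ℕ)) / 2) → ℝ := fun j => (q.dir ⟨k, j⟩ (mult lam) : ℝ) with hs
      have h4 : #{j | s j ≠ 0} = #{j : Fin (16 ^ (i + (k : ℕ)) / 2) |
          q.dir ⟨k, j⟩ (mult lam) ≠ 0} := by
        congr 1; ext j; simp [hs]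
      have h5 : (16 : ℝ) ^ (i + (k : ℕ)) / 4 ≤ (#{j | s j ≠ 0} : ℝ) := by
        rw [h4, div_le_iff₀ (by norm_num), mul_comm]
        have h3' : ((16 ^ (i + (k : ℕ)) : ℕ) : ℝ) ≤ ((4 * #{j : Fin (16 ^ (i + (k : ℕ)) / 2) |
          q.dir ⟨k, j⟩ (mult lam) ≠ 0} : ℕ) : ℝ) := by
          refine Nat.cast_le.2 ?_
          convert h3
        push_cast at h3'
        exact h3'
      have h6 : (4 : ℝ) ^ (i + (k : ℕ)) / 2 ≤ √(#{j | s j ≠ 0} : ℝ) := by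
        apply Real.le_sqrt_of_sq_le
        refine le_trans (le_of_eq ?_) h5
        rw [div_pow, ← pow_mul, mul_comm _ 2, pow_mul]; norm_num
      have hbk : (0 : ℝ) < b k := by exact_mod_cast hb k
      have h7 := card_signs_sub_le s (fun j => by
          rcases q.dir_eq ⟨k, j⟩ (mult lam) with h | h | h <;> simp [hs, h])
        (A := q.center lam mu (2 * 16 ^ (i + (k : ℕ))))
        (w := 16 ^ (i + (k : ℕ)) * b k / 2) hD (by positivity) (t1.trans h5) (by
          have e1 : 16 ^ (i + (k : ℕ)) * b k / 4 * (D * 4 ^ (i + (k : ℕ)))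
              ≤ 16 ^ (i + (k : ℕ)) * b k / 2 * (D * √(#{j | s j ≠ 0} : ℝ)) := by
            calc _ = 16 ^ (i + (k : ℕ)) * b k / 2 * (D * ((4 : ℝ) ^ (i + (k : ℕ)) / 2)) := by ring
              _ ≤ _ := by gcongr
          have := (abs_lt.1 t3).1
          linarith)
      rw [Fintype.card_fin] at h7
      exact h7
    · rw [one_mul]
      have : #{f | P k f} ≤ 2 ^ (16 ^ (i + (k : ℕ)) / 2) :=
        (Finset.card_le_univ _).trans (by simp)
      exact_mod_cast this
  calc _ ≤ ((∏ k, #{f | P k f} : ℕ) : ℝ) := by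
        refine Nat.cast_le.2 ?_
        convert h1
    _ = ∏ k, (#{f | P k f} : ℝ) := by push_cast; rfl
    _ ≤ ∏ k : Fin K, ((if k ∈ T then 1 - δ else 1) * 2 ^ (16 ^ (i + (k : ℕ)) / 2)) :=
        Finset.prod_le_prod (fun _ _ => Nat.cast_nonneg _) fun k _ => h2 k
    _ = _ := by
        rw [Finset.prod_mul_distrib, Finset.prod_ite, Finset.prod_const_one, mul_one,
          Finset.prod_const]
        congr 2
        · congr 1; ext k; simp
        · simp [Finset.prod_pow_eq_pow_sum]

lemma half_le_card_of_sum_le {K : ℕ} (x : Fin K → ℝ) (hx : ∀ k, 0 ≤ x k) {c : ℝ} (hc : 0 < c)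
    (h : ∑ k, x k ≤ c * K) : (K : ℝ) / 2 ≤ #{k | x k ≤ 2 * c} := by
  have h1 := Finset.card_filter_add_card_filter_not (s := (univ : Finset (Fin K)))
    (fun k => x k ≤ 2 * c)
  rw [Finset.card_univ, Fintype.card_fin] at h1
  have h2 : (#{k | ¬ x k ≤ 2 * c} : ℝ) * (2 * c) ≤ c * K := by
    rw [← nsmul_eq_mul]
    refine (Finset.card_nsmul_le_sum _ x _ fun k hk => ?_).trans
      ((Finset.sum_le_sum_of_subset_of_nonneg (Finset.subset_univ _) fun _ _ _ => hx _).trans h)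
    exact (not_le.1 (Finset.mem_filter.1 hk).2).le
  have h3 : (#{k | x k ≤ 2 * c} : ℝ) + #{k | ¬ x k ≤ 2 * c} = K := by exact_mod_cast h1
  nlinarith

lemma macdonaldProb_eq (n : ℕ) [DecidablePred fun p : n.Partition × n.Partition =>
    DominatedBy p.2 p.1] :
    macdonaldProb n = #{p : n.Partition × n.Partition | DominatedBy p.2 p.1}
      / (numPart n : ℝ) ^ 2 := by
  have hD : DiscreteMeasurableSpace n.Partition := ⟨fun _ => trivial⟩
  have hprob : MeasureTheory.IsProbabilityMeasure (uniformPartition n) := by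
    unfold uniformPartition
    exact ProbabilityTheory.isProbabilityMeasure_uniformOn Set.finite_univ Set.univ_nonempty
  have h1 : ∀ lam : n.Partition, (uniformPartition n).real {lam} = 1 / numPart n := by
    intro lam
    rw [MeasureTheory.measureReal_def, uniformPartition, ProbabilityTheory.uniformOn_univ]
    simp [numPart]
  have h2 : ∀ p : n.Partition × n.Partition,
      ((uniformPartition n).prod (uniformPartition n)).real {p} = 1 / (numPart n : ℝ) ^ 2 := by
    rintro ⟨lam, mu⟩
    rw [← Set.singleton_prod_singleton, MeasureTheory.measureReal_prod_prod, h1, h1]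
    field_simp
  have h3 : {p : n.Partition × n.Partition | DominatedBy p.2 p.1}
      = ((univ.filter fun p : n.Partition × n.Partition => DominatedBy p.2 p.1 : Finset _) :
        Set (n.Partition × n.Partition)) := by
    ext p; simp
  rw [macdonaldProb, h3, ← MeasureTheory.sum_measureReal_singleton]
  rw [Finset.sum_congr rfl fun p _ => h2 p, Finset.sum_const, nsmul_eq_mul]
  ring

/-! ### The polynomial bound -/

lemma sixteen_pow_le_exp (m : ℕ) : (16 : ℝ) ^ m ≤ Real.exp (3 * m) := by
  have h : (16 : ℝ) ≤ Real.exp 3 := by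
    have : Real.exp 3 = Real.exp 1 ^ 3 := by rw [← Real.exp_nat_mul]; norm_num
    rw [this]
    calc (16 : ℝ) ≤ 2.7182818283 ^ 3 := by norm_num
      _ ≤ _ := by gcongr; exact Real.exp_one_gt_d9.le
  calc (16 : ℝ) ^ m ≤ Real.exp 3 ^ m := by gcongr
    _ = _ := by rw [← Real.exp_nat_mul]; ring_nf

lemma add_one_pow_le_exp {n K : ℕ} (h : n + 1 ≤ 16 ^ (16 * K)) (C : ℕ) :
    ((n : ℝ) + 1) ^ C ≤ Real.exp (48 * C * K) := by
  have h1 : (n : ℝ) + 1 ≤ Real.exp (48 * K) := by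
    have : (n : ℝ) + 1 ≤ 16 ^ (16 * K) := by exact_mod_cast h
    refine this.trans ((sixteen_pow_le_exp _).trans (le_of_eq ?_))
    congr 1; push_cast; ring
  calc ((n : ℝ) + 1) ^ C ≤ Real.exp (48 * K) ^ C := by gcongr
    _ = _ := by rw [← Real.exp_nat_mul]; ring_nf

/-- Take `b k` to be the integer part of `√n / (50000 r)`. Since `√n ≥ 16 ^ (4 * K)` is much larger
than `r ≤ 16 ^ (2 * K)`, rounding loses at most half. -/
lemma exists_steps {n K : ℕ} (hK : 3 ≤ K) (hn : 16 ^ (8 * K) ≤ n) : ∃ b : Fin K → ℕ,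
    (∀ k, 0 < b k) ∧ (∀ k : Fin K, 50000 * (((16 ^ (K + (k : ℕ)) : ℕ) : ℝ) * b k) ≤ √n) ∧
    ∀ k : Fin K, √n / 100000 ≤ (16 : ℝ) ^ (K + (k : ℕ)) * b k := by
  have hn' : (16 : ℝ) ^ (8 * K) ≤ n := by exact_mod_cast hn
  have hs : (16 : ℝ) ^ (4 * K) ≤ √n := by
    apply Real.le_sqrt_of_sq_le
    rw [← pow_mul]
    refine le_trans (le_of_eq ?_) hn'
    congr 1; ring
  have hs0 : 0 < √(n : ℝ) := lt_of_lt_of_le (by positivity) hs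
  have hr : ∀ k : Fin K, 100000 * (16 : ℝ) ^ (K + (k : ℕ)) ≤ √n := by
    intro k
    refine le_trans ?_ hs
    calc 100000 * (16 : ℝ) ^ (K + (k : ℕ)) ≤ 16 ^ (2 * 3) * 16 ^ (2 * K) := by
          gcongr
          · norm_num
          · norm_num
          · omega
      _ ≤ 16 ^ (2 * K) * 16 ^ (2 * K) := by gcongr; norm_num
      _ = _ := by rw [← pow_add]; ring_nf
  have hlow : ∀ k : Fin K, √n / 100000
      ≤ (16 : ℝ) ^ (K + (k : ℕ)) * ⌊√(n : ℝ) / (50000 * 16 ^ (K + (k : ℕ)))⌋₊ := by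
    intro k
    have h1 := Nat.sub_one_lt_floor (√(n : ℝ) / (50000 * 16 ^ (K + (k : ℕ))))
    have hr0 : (0 : ℝ) < 16 ^ (K + (k : ℕ)) := by positivity
    have h2 := mul_le_mul_of_nonneg_left h1.le hr0.le
    have h3 : (16 : ℝ) ^ (K + (k : ℕ)) * (√(n : ℝ) / (50000 * 16 ^ (K + (k : ℕ))) - 1)
        = √n / 50000 - 16 ^ (K + (k : ℕ)) := by field_simp
    rw [h3] at h2
    have := hr k
    linarith
  refine ⟨fun k => ⌊√(n : ℝ) / (50000 * 16 ^ (K + (k : ℕ)))⌋₊, fun k => ?_, fun k => ?_, hlow⟩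
  · by_contra hcon
    have h := hlow k
    have h0 : ⌊√(n : ℝ) / (50000 * 16 ^ (K + (k : ℕ)))⌋₊ = 0 := Nat.eq_zero_of_not_pos hcon
    rw [h0, Nat.cast_zero, mul_zero] at h
    have : 0 < √(n : ℝ) / 100000 := by positivity
    linarith
  · have h1 : (⌊√(n : ℝ) / (50000 * 16 ^ (K + (k : ℕ)))⌋₊ : ℝ)
        ≤ √(n : ℝ) / (50000 * 16 ^ (K + (k : ℕ))) := Nat.floor_le (by positivity)
    push_cast
    calc _ ≤ 50000 * ((16 : ℝ) ^ (K + (k : ℕ)) * (√(n : ℝ) / (50000 * 16 ^ (K + (k : ℕ))))) := by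
          gcongr
      _ = _ := by field_simp

lemma mul_exp_neg_sixteen_pow_le {C K : ℕ} (h : 48 * C + 2 ≤ K) :
    (K : ℝ) * (Real.exp (48 * C * K) * Real.exp (-(16 : ℝ) ^ K)) ≤ Real.exp (-K) := by
  have h1 : (K : ℝ) ≤ Real.exp K := by linarith [Real.add_one_le_exp (K : ℝ)]
  have h2 : (K : ℝ) * K ≤ 16 ^ K := by
    have h3 : (K : ℝ) ≤ 2 ^ K := by exact_mod_cast (Nat.lt_two_pow_self).le
    calc (K : ℝ) * K ≤ 2 ^ K * 2 ^ K := by gcongr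
      _ = 4 ^ K := by rw [← mul_pow]; norm_num
      _ ≤ 16 ^ K := by gcongr; norm_num
  have h4 : ((48 : ℝ) * C + 2) ≤ K := by exact_mod_cast h
  calc _ ≤ Real.exp K * (Real.exp (48 * C * K) * Real.exp (-(16 : ℝ) ^ K)) := by gcongr
    _ = Real.exp (K + (48 * C * K + -(16 : ℝ) ^ K)) := by rw [Real.exp_add, Real.exp_add]
    _ ≤ _ := by
      apply Real.exp_le_exp.2
      nlinarith [mul_le_mul_of_nonneg_right h4 (Nat.cast_nonneg' (α := ℝ) K)]

lemma sum_indicator_pairs {α : Type*} [Fintype α] [DecidableEq α] (S : Finset α)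
    (U : Finset (α × α)) (E : ℝ) :
    ∑ x : α × α, (E + (if x.1 ∈ S then 1 else 0) + (if x ∈ U then 1 else 0))
      = E * (Fintype.card α : ℝ) ^ 2 + #S * Fintype.card α + #U := by
  have h1 : ∑ x : α × α, (if x.1 ∈ S then (1 : ℝ) else 0) = #S * Fintype.card α := by
    rw [Fintype.sum_prod_type, Finset.sum_comm]
    simp [mul_comm]
  have h2 : ∑ x : α × α, (if x ∈ U then (1 : ℝ) else 0) = #U := by simp
  rw [Finset.sum_add_distrib, Finset.sum_add_distrib, Finset.sum_const, Finset.card_univ,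
    Fintype.card_prod, nsmul_eq_mul, h1, h2]
  push_cast
  ring

-- The lower bound on `n` leaves room for `K` scales, and the upper one turns powers of `n` into
-- `exp (O(K))`. Off the exceptional sets `small` and `large`, an orbit is dominated with proportion
-- at most `(1 - δ) ^ (K / 2)`.
set_option maxHeartbeats 1000000 in
open Classical in
theorem exists_macdonaldProb_le : ∃ A : ℝ, 0 < A ∧ ∃ c : ℝ, 0 < c ∧ ∃ K₀ : ℕ, ∀ n K : ℕ, K₀ ≤ K →
    16 ^ (8 * K) ≤ n → n + 1 ≤ 16 ^ (16 * K) → macdonaldProb n ≤ A * Real.exp (-(c * K)) := by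
  obtain ⟨C₁, B₁, hB₁, hsmall⟩ := exists_card_small_mult_le
  obtain ⟨C₂, B₂, hB₂, hdisc⟩ := exists_sum_exp_disc_le
  -- `48 * C₂` pays for the polynomial factor, one unit for the `2 ^ K` sign patterns, and one is
  -- left over as the decay `exp (-K)`.
  set L : ℝ := 48 * C₂ + 2 with hL
  have hL0 : 0 < L := by positivity
  -- Makes the guaranteed fluctuation `50 L √n 4 ^ (K + k)`, above the bound `40 L √n 4 ^ (K + k)`
  -- on a good center.
  set D : ℝ := 2 * 10 ^ 7 * L with hD
  have hD0 : 0 < D := by positivity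
  set δ : ℝ := Real.exp (-(4 * D + 4) ^ 2) / 4 with hδ
  have hδ0 : 0 < δ := by positivity
  have hδ1 : δ ≤ 1 := by
    have : Real.exp (-(4 * D + 4) ^ 2) ≤ 1 := by
      rw [← Real.exp_zero]
      exact Real.exp_le_exp.2 (by nlinarith [sq_nonneg (4 * D + 4)])
    rw [hδ]; linarith
  obtain ⟨K₁, hK₁⟩ := pow_unbounded_of_one_lt (4 * (4 * D + 4) ^ 2) (show (1 : ℝ) < 16 by norm_num)
  refine ⟨1 + B₁ + B₂, by positivity, δ / 2, by positivity, max K₁ (48 * C₁ + 3), ?_⟩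
  intro n K hK hn hn2
  have hKK₁ : K₁ ≤ K := le_trans (le_max_left _ _) hK
  have hKC : 48 * C₁ + 3 ≤ K := le_trans (le_max_right _ _) hK
  have hi : 0 < K := by omega
  have hn0 : 0 < n := lt_of_lt_of_le (by positivity) hn
  obtain ⟨b, hb, hb1, hb2⟩ := exists_steps (by omega : 3 ≤ K) hn
  have h4n : ∀ k < K, 4 * 16 ^ (K + k) ≤ n := by
    intro k hk
    refine le_trans ?_ hn
    calc 4 * 16 ^ (K + k) ≤ 16 ^ 1 * 16 ^ (K + k) := by gcongr; norm_num
      _ = 16 ^ (1 + (K + k)) := (pow_add _ _ _).symm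
      _ ≤ _ := Nat.pow_le_pow_right (by norm_num) (by omega)
  set q := scaleSystem n K K hi h4n b hb with hq
  set p : ℝ := ((numPart n : ℕ) : ℝ) with hp
  have hp0 : 0 < p := by rw [hp]; exact_mod_cast numPart_pos n
  have hs0 : 0 < √(n : ℝ) := Real.sqrt_pos.2 (by exact_mod_cast hn0)
  set θ : Fin K → ℝ := fun k => 1 / (20 * √n) / 4 ^ (K + (k : ℕ)) with hθ
  set small : Finset n.Partition := {lam | ∃ k : Fin K, 16 ^ (K + (k : ℕ)) <
    4 * #{s ∈ Ioc (16 ^ (K + (k : ℕ))) (4 * 16 ^ (K + (k : ℕ))) | mult lam s < b k}} with hsm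
  set large : Finset (n.Partition × n.Partition) :=
    {x | L * K < ∑ k, |θ k * q.center x.1 x.2 (2 * 16 ^ (K + (k : ℕ)))|} with hlg
  have hsmallcard : (#small : ℝ) ≤ B₁ * Real.exp (-K) * p := by
    have h1 : small ⊆ univ.biUnion fun k : Fin K => ({lam | 16 ^ (K + (k : ℕ)) <
        4 * #{s ∈ Ioc (16 ^ (K + (k : ℕ))) (4 * 16 ^ (K + (k : ℕ))) | mult lam s < b k}} :
        Finset n.Partition) := by
      intro lam hlam
      obtain ⟨k, hk⟩ := (Finset.mem_filter.1 hlam).2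
      exact Finset.mem_biUnion.2 ⟨k, Finset.mem_univ _, Finset.mem_filter.2 ⟨Finset.mem_univ _, hk⟩⟩
    have h2 : (#small : ℝ) ≤ ∑ k : Fin K, (#({lam | 16 ^ (K + (k : ℕ)) <
        4 * #{s ∈ Ioc (16 ^ (K + (k : ℕ))) (4 * 16 ^ (K + (k : ℕ))) | mult lam s < b k}} :
        Finset n.Partition) : ℝ) := by
      exact_mod_cast (Finset.card_le_card h1).trans Finset.card_biUnion_le
    have h3 : ∀ k : Fin K, (#({lam | 16 ^ (K + (k : ℕ)) <
        4 * #{s ∈ Ioc (16 ^ (K + (k : ℕ))) (4 * 16 ^ (K + (k : ℕ))) | mult lam s < b k}} :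
        Finset n.Partition) : ℝ)
        ≤ B₁ * Real.exp (48 * C₁ * K) * p * Real.exp (-(16 : ℝ) ^ K) := by
      intro k
      have h4 := hsmall n hn0 (16 ^ (K + (k : ℕ))) (b k) (h4n k k.2) (hb1 k)
      refine le_trans ?_ (h4.trans ?_)
      · refine le_of_eq ?_
        congr 2
      · have h5 : (16 : ℝ) ^ K ≤ ((16 ^ (K + (k : ℕ)) : ℕ) : ℝ) := by
          push_cast
          exact pow_le_pow_right₀ (by norm_num) (by omega)
        have h6 := add_one_pow_le_exp hn2 C₁
        gcongr
    refine h2.trans ((Finset.sum_le_sum fun k _ => h3 k).trans ?_)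
    rw [Finset.sum_const, Finset.card_univ, Fintype.card_fin, nsmul_eq_mul]
    have h7 := mul_exp_neg_sixteen_pow_le (C := C₁) (K := K) (by omega)
    calc _ = B₁ * (K * (Real.exp (48 * C₁ * K) * Real.exp (-(16 : ℝ) ^ K))) * p := by ring
      _ ≤ _ := by gcongr
  have hlargecard : (#large : ℝ) ≤ B₂ * Real.exp (-K) * p ^ 2 := by
    have h1 : (#large : ℝ) * Real.exp (L * K)
        ≤ 2 ^ K * (B₂ * ((n : ℝ) + 1) ^ C₂ * p ^ 2) := by
      refine le_trans ?_ ((q.sum_exp_center_le θ fun k => 2 * 16 ^ (K + (k : ℕ))).trans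
        (hdisc n hn0 K K))
      rw [← Fintype.sum_prod_type' (f := fun lam mu : n.Partition =>
        Real.exp (∑ k, |θ k * q.center lam mu (2 * 16 ^ (K + (k : ℕ)))|)), ← nsmul_eq_mul]
      refine (Finset.card_nsmul_le_sum large _ _ fun x hx => ?_).trans
        (Finset.sum_le_sum_of_subset_of_nonneg (Finset.subset_univ _)
          fun _ _ _ => (Real.exp_pos _).le)
      exact Real.exp_le_exp.2 (Finset.mem_filter.1 hx).2.le
    have h2 : (2 : ℝ) ^ K ≤ Real.exp K := by
      have : (2 : ℝ) ≤ Real.exp 1 := by linarith [Real.add_one_le_exp (1 : ℝ)]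
      calc (2 : ℝ) ^ K ≤ Real.exp 1 ^ K := by gcongr
        _ = _ := by rw [← Real.exp_nat_mul, mul_one]
    have h3 := add_one_pow_le_exp hn2 C₂
    refine le_of_mul_le_mul_right (h1.trans ?_) (Real.exp_pos (L * K))
    calc _ ≤ Real.exp K * (B₂ * Real.exp (48 * C₂ * K) * p ^ 2) := by gcongr
      _ = B₂ * (Real.exp (K + 48 * C₂ * K)) * p ^ 2 := by rw [Real.exp_add]; ring
      _ = B₂ * (Real.exp (-K + L * K)) * p ^ 2 := by congr 3; rw [hL]; ring
      _ = _ := by rw [Real.exp_add]; ring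
  set M : ℝ := ((Fintype.card (ScaleIndex K K → Bool) : ℕ) : ℝ) with hM
  have hM0 : 0 < M := by rw [hM]; exact_mod_cast Fintype.card_pos
  have hpair : ∀ x : n.Partition × n.Partition,
      (#{e : ScaleIndex K K → Bool | DominatedBy x.2 (q.flip e x.1)} : ℝ)
        ≤ (Real.exp (-(δ / 2 * K)) + (if x.1 ∈ small then 1 else 0)
          + (if x ∈ large then 1 else 0)) * M := by
    rintro ⟨lam, mu⟩
    have htriv : (#{e : ScaleIndex K K → Bool | DominatedBy mu (q.flip e lam)} : ℝ) ≤ M := by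
      rw [hM]; exact_mod_cast Finset.card_le_univ _
    have hE := Real.exp_pos (-(δ / 2 * K))
    by_cases h1 : lam ∈ small
    · refine htriv.trans (le_mul_of_one_le_left hM0.le ?_)
      rw [if_pos h1]
      split_ifs <;> linarith
    by_cases h2 : (lam, mu) ∈ large
    · refine htriv.trans (le_mul_of_one_le_left hM0.le ?_)
      rw [if_pos h2]
      split_ifs <;> linarith
    rw [if_neg h1, if_neg h2, add_zero, add_zero]
    have h1' : ∀ k : Fin K, 4 * #{s ∈ Ioc (16 ^ (K + (k : ℕ))) (4 * 16 ^ (K + (k : ℕ))) |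
        mult lam s < b k} ≤ 16 ^ (K + (k : ℕ)) := by
      intro k
      by_contra hcon
      exact h1 (Finset.mem_filter.2 ⟨Finset.mem_univ _, k, not_le.1 hcon⟩)
    have h2' : ∑ k, |θ k * q.center lam mu (2 * 16 ^ (K + (k : ℕ)))| ≤ L * K := by
      by_contra hcon
      exact h2 (Finset.mem_filter.2 ⟨Finset.mem_univ _, not_le.1 hcon⟩)
    -- By Markov's inequality at least half of the levels have a normalised center within twice the
    -- average bound.
    set T : Finset (Fin K) := {k | |θ k * q.center lam mu (2 * 16 ^ (K + (k : ℕ)))| ≤ 2 * L} with hT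
    have hTcard : (K : ℝ) / 2 ≤ #T := half_le_card_of_sum_le _ (fun _ => abs_nonneg _) hL0 h2'
    have h3 := card_dominatedBy_flip_le (hi := hi) (hn := h4n) (hb := hb) lam mu hD0 T (by
      intro k hk
      refine ⟨?_, h1' k, ?_⟩
      · have : (16 : ℝ) ^ K₁ ≤ 16 ^ (K + (k : ℕ)) := pow_le_pow_right₀ (by norm_num) (by omega)
        linarith
      · have h5 := (Finset.mem_filter.1 hk).2
        have hθ0 : 0 < θ k := by simp only [hθ]; positivity
        rw [abs_mul, abs_of_pos hθ0, mul_comm, ← le_div_iff₀ hθ0] at h5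
        refine lt_of_le_of_lt h5 ?_
        have h6 := hb2 k
        have e1 : 2 * L / θ k = 40 * L * (√n * 4 ^ (K + (k : ℕ))) := by
          simp only [hθ]; field_simp; norm_num
        rw [e1]
        calc 40 * L * (√n * 4 ^ (K + (k : ℕ)))
            < 50 * L * (√n * 4 ^ (K + (k : ℕ))) := by gcongr; norm_num
          _ = √n / 100000 / 4 * (D * 4 ^ (K + (k : ℕ))) := by rw [hD]; ring
          _ ≤ _ := by gcongr)
    refine h3.trans ?_
    rw [← hδ, ← hM]
    refine mul_le_mul_of_nonneg_right ?_ hM0.le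
    calc (1 - δ) ^ #T ≤ Real.exp (-δ) ^ #T :=
          pow_le_pow_left₀ (by linarith) (Real.one_sub_le_exp_neg δ) _
      _ = Real.exp (-(δ * #T)) := by rw [← Real.exp_nat_mul]; ring_nf
      _ ≤ _ := by apply Real.exp_le_exp.2; nlinarith
  have hcount : (#{x : n.Partition × n.Partition | DominatedBy x.2 x.1} : ℝ) * M
      ≤ (Real.exp (-(δ / 2 * K)) * p ^ 2 + #small * p + #large) * M := by
    have h1 : (#{x : n.Partition × n.Partition | DominatedBy x.2 x.1} : ℝ) * M
        = ∑ x : n.Partition × n.Partition,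
          (#{e : ScaleIndex K K → Bool | DominatedBy x.2 (q.flip e x.1)} : ℝ) := by
      rw [hM]; exact_mod_cast q.card_dominatedBy_mul
    rw [h1]
    refine (Finset.sum_le_sum fun x _ => hpair x).trans (le_of_eq ?_)
    rw [← Finset.sum_mul, sum_indicator_pairs]
    rfl
  have hcount' := le_of_mul_le_mul_right hcount hM0
  have hexp : Real.exp (-(K : ℝ)) ≤ Real.exp (-(δ / 2 * K)) := by
    apply Real.exp_le_exp.2
    have : (0 : ℝ) ≤ K := Nat.cast_nonneg _
    nlinarith
  rw [macdonaldProb_eq, div_le_iff₀ (by positivity)]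
  calc _ ≤ Real.exp (-(δ / 2 * K)) * p ^ 2 + #small * p + #large := hcount'
    _ ≤ Real.exp (-(δ / 2 * K)) * p ^ 2 + B₁ * Real.exp (-K) * p * p
        + B₂ * Real.exp (-K) * p ^ 2 := by gcongr
    _ ≤ Real.exp (-(δ / 2 * K)) * p ^ 2 + B₁ * Real.exp (-(δ / 2 * K)) * p * p
        + B₂ * Real.exp (-(δ / 2 * K)) * p ^ 2 := by gcongr
    _ = _ := by ring

/-- The dominance probability decays polynomially. -/
theorem exists_macdonaldProb_le_log : ∃ A : ℝ, 0 < A ∧ ∃ c : ℝ, 0 < c ∧ ∃ N : ℕ, ∀ n : ℕ, N ≤ n →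
    macdonaldProb n ≤ A * Real.exp (-(c * Real.log n)) := by
  obtain ⟨A, hA, c, hc, K₀, h⟩ := exists_macdonaldProb_le
  refine ⟨A, hA, c / 48, by positivity, 16 ^ (8 * (K₀ + 1)), fun n hn => ?_⟩
  have hn0 : n ≠ 0 := (lt_of_lt_of_le (by positivity) hn).ne'
  have hlog : 8 * (K₀ + 1) ≤ Nat.log 16 n := Nat.le_log_of_pow_le (by norm_num) hn
  set K := Nat.log 16 n / 8 with hK
  have hK0 : K₀ + 1 ≤ K := by omega
  have h1 : 16 ^ (8 * K) ≤ n :=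
    (Nat.pow_le_pow_right (by norm_num) (by omega)).trans (Nat.pow_log_le_self 16 hn0)
  have h2 : n + 1 ≤ 16 ^ (16 * K) :=
    (Nat.lt_pow_succ_log_self (by norm_num) n).trans_le
      (Nat.pow_le_pow_right (by norm_num) (by omega))
  refine (h n K (by omega) h1 h2).trans
    (mul_le_mul_of_nonneg_left (Real.exp_le_exp.2 (neg_le_neg ?_)) hA.le)
  have h3 := add_one_pow_le_exp h2 1
  have hn1 : (0 : ℝ) < n := by exact_mod_cast Nat.pos_of_ne_zero hn0
  have h4 : Real.log n ≤ 48 * K := by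
    rw [Real.log_le_iff_le_exp hn1]
    simp only [pow_one, Nat.cast_one, mul_one] at h3
    linarith
  calc c / 48 * Real.log n ≤ c / 48 * (48 * K) := by gcongr
    _ = c * K := by ring

end RandomPartition

theorem theorem4p1 :
    ∃ N : ℕ, ∀ n : ℕ, N ≤ n →
      RandomPartition.macdonaldProb n ≤
        Real.exp (-(0.11 * Real.log (n : ℝ) / Real.log (Real.log (n : ℝ)))) := by
  obtain ⟨A, hA, c, hc, N, h⟩ := RandomPartition.exists_macdonaldProb_le_log
  have hlog : Filter.Tendsto (fun n : ℕ => Real.log (n : ℝ)) Filter.atTop Filter.atTop :=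
    Real.tendsto_log_atTop.comp tendsto_natCast_atTop_atTop
  have hloglog := Real.tendsto_log_atTop.comp hlog
  obtain ⟨N₁, hN₁⟩ := Filter.eventually_atTop.1
    ((hlog.eventually_ge_atTop (2 * Real.log A / c)).and
      ((hlog.eventually_ge_atTop 0).and ((hloglog.eventually_ge_atTop (0.22 / c)))))
  refine ⟨max N N₁, fun n hn => (h n (le_trans (le_max_left _ _) hn)).trans ?_⟩
  obtain ⟨h1, h2, h3⟩ := hN₁ n (le_trans (le_max_right _ _) hn)
  simp only [Function.comp_apply] at h3
  set l := Real.log (n : ℝ)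
  have hll : 0 < Real.log l := lt_of_lt_of_le (by positivity) h3
  rw [← Real.exp_log hA, ← Real.exp_add]
  apply Real.exp_le_exp.2
  rw [div_le_iff₀ hc] at h1 h3
  -- Half of the exponent `c * log n` absorbs the iterated-logarithm target, and the other half
  -- absorbs `log A`.
  have h4 : 0.11 * l / Real.log l ≤ c / 2 * l := by
    rw [div_le_iff₀ hll]
    nlinarith
  linarith
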